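/- **Setting.** Let $R$ be a commutative ring and let $A=\bigoplus_{j\in\mathbb Z}A_j$ be a commutative $\mathbb Z$-graded $R$-algebra with unit such that each $A_j$ is a free $R$-module of finite rank. Let $G=(V,E)$ be a finite simple graph with a fixed ordering $E=\{e_1,\dots,e_m\}$ of its edges. For $S\subseteq E$ let $k(S)$ be the number of connected components of the spanning subgraph $(V,S)$. A *broken circuit* is a set $C\setminus\{f\}$, where $C\subseteq E$ is the edge set of a cycle of $G$ and $f$ is the largest edge of $C$. Let $\mathrm{NBC}\subseteq 2^E$ be the lower order ideal of all $S\subseteq E$ that contain no broken circuit, and $\mathrm{BC}=2^E\setminus\mathrm{NBC}$. The *chromatic functor* $F=F^{\mathrm{Ch}}_{G,A}$ goes from the Boolean lattice $2^E$ (ordered by inclusion) to graded $R$-modules with degree-preserving maps. It sends $S$ to $A^{\otimes k(S)}$, with one tensor factor for each component of $(V,S)$ and the total grading. It sends $S\subseteq S\cup\{e\}$, $e\notin S$, to the map that multiplies the two tensor factors of the components joined by $e$, if $e$ joins two different components, and to the identity otherwise. Let $P=2^E$ or $P=\mathrm{NBC}$. The cochain complex of $F|_P$ is $$C^i(F|_P)=\bigoplus_{S\in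 P,\ |S|=i}F(S),\qquad \delta^i=\sum_{S,\,S\cup\{e_l\}\in P,\ |S|=i,\ e_l\notin S}(-1)^{\#\{h<l\,:\,e_h\in S\}}\,F(S\subset S\cup\{e_l\}),$$ and $H^i(F|_P)$ is its cohomology, a graded $R$-module. For $P=2^E$ this is the Helme-Guizon–Rong chromatic homology $H^*(F)$. **Theorem (Categorification of Whitney's Broken Circuit theorem).** 1. For every $i$ there is an isomorphism of graded $R$-modules $H^i(F)\cong H^i(F|_{\mathrm{NBC}})$. 2. Taking Euler characteristics recovers Whitney's theorem, in the following sense. There is a polynomial $\chi_G\in\mathbb Z[x]$ (the chromatic polynomial) such that, for all $n\in\mathbb N$, $\chi_G(n)$ is the number of proper colorings $V\to\{1,\dots,n\}$ of $G$, and $$\sum_{S\in\mathrm{BC}}(-1)^{|S|}x^{k(S)}=0,\qquad \chi_G(x)=\sum_{S\in\mathrm{NBC}}(-1)^{|S|}x^{k(S)}.$$ For a finitely generated graded module $M$ over a principal ideal domain write $q\mathrm{rk}\,M=\sum_j(\mathrm{rk}\,M_j)\,q^j\in\mathbb Z[q,q^{-1}]$. If $R$ is a principal ideal domain and $A$ is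 finitely generated as an $R$-module, then $H^*(F)$ and $H^*(F|_{\mathrm{NBC}})$ are finitely generated, and the graded Euler characteristics of the two sides of the isomorphism in 1 are the two sides of Whitney's formula at $x=q\mathrm{rk}\,A$: $$\sum_i(-1)^i\,q\mathrm{rk}\,H^i(F)=\chi_G(q\mathrm{rk}\,A),\qquad \sum_i(-1)^i\,q\mathrm{rk}\,H^i(F|_{\mathrm{NBC}})=\sum_{S\in\mathrm{NBC}}(-1)^{|S|}(q\mathrm{rk}\,A)^{k(S)}.$$ -/

import Mathlib

open CategoryTheory
open scoped TensorProduct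

noncomputable section

/-! ### Cohomology of functors on thin posets -/

/-- A rank function making `P` a thin poset, together with a balanced coloring of its cover
relations. Only the values `sign x y` with `x ⋖ y` matter. In a diamond `{x, a, b, y}` the product
of the four signs is `-1` exactly when an odd number of its cover relations has sign `-1`. -/
structure BalancedThin (P : Type*) [PartialOrder P] where
  rk : P → ℕ
  rk_covBy : ∀ x y : P, x ⋖ y → rk y = rk x + 1
  thin : ∀ x y : P, x ≤ y → rk y = rk x + 2 → (Set.Icc x y).ncard = 4
  sign : P → P → ℤˣ
  balanced : ∀ x a b y : P, x ⋖ a → a ⋖ y → x ⋖ b → b ⋖ y → a ≠ b →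
    sign x a * sign a y * (sign x b * sign b y) = -1

namespace BalancedThin

/-- The restriction of a balanced thin structure to a lower order ideal. -/
def restrict {P : Type*} [PartialOrder P] (D : BalancedThin P) (I : Set P) (hI : IsLowerSet I) :
    BalancedThin I :=
  have hcov : ∀ x y : I, x ⋖ y → (x : P) ⋖ (y : P) := fun x y h =>
    ⟨h.1, fun z hxz hzy => h.2 (c := ⟨z, hI hzy.le y.2⟩) hxz hzy⟩
  { rk := fun x => D.rk x
    rk_covBy := fun x y h => D.rk_covBy x y (hcov x y h)
    thin := fun x y h hr => by
      rw [← D.thin x y h hr, ← Set.ncard_image_of_injective _ Subtype.val_injective]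
      congr 1
      ext z
      constructor
      · rintro ⟨w, hw, rfl⟩
        exact hw
      · intro hz
        exact ⟨⟨z, hI hz.2 y.2⟩, hz, rfl⟩
    sign := fun x y => D.sign x y
    balanced := fun x a b y h1 h2 h3 h4 hab =>
      D.balanced x a b y (hcov _ _ h1) (hcov _ _ h2) (hcov _ _ h3) (hcov _ _ h4)
        (fun h => hab (Subtype.ext h)) }

/-- A diamond has exactly two middle elements. -/
lemma middle {P : Type*} [PartialOrder P] (D : BalancedThin P) {x a y : P} (hxa : x ⋖ a) (hay : a ⋖ y) :
    ∃ b, b ≠ a ∧ x ⋖ b ∧ b ⋖ y ∧ ∀ z, x ⋖ z → z ⋖ y → z = a ∨ z = b := by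
  have hr : D.rk y = D.rk x + 2 := by rw [D.rk_covBy _ _ hay, D.rk_covBy _ _ hxa]
  have h4 := D.thin x y (hxa.le.trans hay.le) hr
  have hxy : x < y := hxa.lt.trans hay.lt
  have h3 : ({x, a, y} : Set P).ncard = 3 := Set.ncard_eq_three.2
    ⟨x, a, y, hxa.lt.ne, hxy.ne, hay.lt.ne, rfl⟩
  have hsub : ({x, a, y} : Set P) ⊆ Set.Icc x y := by
    rintro z (rfl | rfl | rfl)
    · exact ⟨le_rfl, hxy.le⟩
    · exact ⟨hxa.le, hay.le⟩
    · exact ⟨hxy.le, le_rfl⟩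
  have hd : (Set.Icc x y \ {x, a, y}).ncard = 1 := by
    rw [Set.ncard_sdiff hsub, h4, h3]
  obtain ⟨b, hb⟩ := Set.ncard_eq_one.1 hd
  have hmem : ∀ z, x ≤ z → z ≤ y → z = x ∨ z = a ∨ z = y ∨ z = b := by
    intro z h1 h2
    by_cases hz : z ∈ ({x, a, y} : Set P)
    · rcases hz with h | h | h
      · exact Or.inl h
      · exact Or.inr (Or.inl h)
      · exact Or.inr (Or.inr (Or.inl h))
    · have : z ∈ ({b} : Set P) := hb ▸ ⟨⟨h1, h2⟩, hz⟩
      exact Or.inr (Or.inr (Or.inr this))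
  have hbm : b ∈ Set.Icc x y \ {x, a, y} := hb ▸ rfl
  obtain ⟨⟨hxb, hby⟩, hbn⟩ := hbm
  simp only [Set.mem_insert_iff, Set.mem_singleton_iff, not_or] at hbn
  obtain ⟨hbx, hba, hbny⟩ := hbn
  have hxb' : x < b := lt_of_le_of_ne hxb (Ne.symm hbx)
  have hby' : b < y := lt_of_le_of_ne hby hbny
  refine ⟨b, hba, ⟨hxb', fun z h1 h2 => ?_⟩, ⟨hby', fun z h1 h2 => ?_⟩, fun z h1 h2 => ?_⟩
  · rcases hmem z h1.le (h2.le.trans hby) with rfl | rfl | rfl | rfl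
    · exact h1.false
    · exact hay.2 h2 hby'
    · exact (h2.trans hby').false
    · exact h2.false
  · rcases hmem z (hxb.trans h1.le) h2.le with rfl | rfl | rfl | rfl
    · exact (h1.trans hxb').false
    · exact hxa.2 hxb' h1
    · exact h2.false
    · exact h1.false
  · rcases hmem z h1.le h2.le with rfl | rfl | rfl | rfl
    · exact absurd h1.lt (lt_irrefl _)
    · exact Or.inl rfl
    · exact absurd h2.lt (lt_irrefl _)
    · exact Or.inr rfl

universe p w u

variable {P : Type p} [PartialOrder P] (D : BalancedThin P)
  {R : Type u} [CommRing R] (F : P ⥤ ModuleCat.{max p w} R)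

/-- `C^k = ⨁_{rk x = k} F(x)`. -/
abbrev Cochain (k : ℕ) : Type (max p w) := (x : {x : P // D.rk x = k}) → F.obj x.1

open Classical in
/-- The component `F(x) → F(y)` of the differential: `sign(x ⋖ y) F(x ⋖ y)` if `x ⋖ y`, and zero
otherwise. -/
def coeff (x y : P) : F.obj x →ₗ[R] F.obj y :=
  if h : x ⋖ y then ((D.sign x y : ℤˣ) : ℤ) • (F.map (homOfLE h.le)).hom else 0

/-- The map `C^k → C^l` with matrix `coeff`; it is zero unless `l = k + 1`. -/
def diff [Finite P] (k l : ℕ) : D.Cochain F k →ₗ[R] D.Cochain F l :=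
  haveI := Fintype.ofFinite {x : P // D.rk x = k}
  LinearMap.pi fun y => ∑ x : {x : P // D.rk x = k}, D.coeff F x.1 y.1 ∘ₗ LinearMap.proj x

lemma coeff_covBy {x y : P} (h : x ⋖ y) :
    D.coeff F x y = ((D.sign x y : ℤˣ) : ℤ) • (F.map (homOfLE h.le)).hom := by
  rw [coeff, dif_pos h]

lemma coeff_not_covBy {x y : P} (h : ¬ x ⋖ y) : D.coeff F x y = 0 := by
  rw [coeff, dif_neg h]

lemma diff_shape [Finite P] (k l : ℕ) (h : k + 1 ≠ l) : D.diff F k l = 0 := by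
  ext f y
  simp only [diff, LinearMap.pi_apply, LinearMap.sum_apply, LinearMap.zero_apply, Pi.zero_apply]
  refine Finset.sum_eq_zero fun x _ => ?_
  rw [coeff_not_covBy]
  · rfl
  · intro hxy
    have := D.rk_covBy _ _ hxy
    rw [x.2, y.2] at this
    exact h this.symm

lemma coeff_comp {x a y : P} (h1 : x ⋖ a) (h2 : a ⋖ y) (v : F.obj x) :
    D.coeff F a y (D.coeff F x a v) = ((D.sign x a * D.sign a y : ℤˣ) : ℤ) •
      (F.map (homOfLE (h1.le.trans h2.le))).hom v := by
  rw [coeff_covBy D F h1, coeff_covBy D F h2]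
  have : F.map (homOfLE (h1.le.trans h2.le)) = F.map (homOfLE h1.le) ≫ F.map (homOfLE h2.le) := by
    rw [← F.map_comp]; rfl
  rw [this, LinearMap.smul_apply, LinearMap.smul_apply, map_zsmul, smul_smul, Units.val_mul,
    mul_comm]
  rfl

lemma diff_comp [Finite P] (k l m : ℕ) : D.diff F l m ∘ₗ D.diff F k l = 0 := by
  by_cases hl : k + 1 = l
  swap
  · rw [diff_shape D F k l hl, LinearMap.comp_zero]
  ext f y
  simp only [diff, LinearMap.comp_apply, LinearMap.pi_apply, LinearMap.sum_apply,
    LinearMap.zero_apply, Pi.zero_apply, LinearMap.proj_apply, map_sum]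
  let _ := Fintype.ofFinite {x : P // D.rk x = k}
  let _ := Fintype.ofFinite {x : P // D.rk x = l}
  rw [Finset.sum_comm]
  refine Finset.sum_eq_zero fun x _ => ?_
  by_cases hex : ∃ a : P, x.1 ⋖ a ∧ a ⋖ y.1
  · obtain ⟨a, hxa, hay⟩ := hex
    obtain ⟨b, hba, hxb, hby, hall⟩ := D.middle hxa hay
    have ha : D.rk a = l := by rw [D.rk_covBy _ _ hxa, x.2, hl]
    have hb : D.rk b = l := by rw [D.rk_covBy _ _ hxb, x.2, hl]
    rw [Finset.sum_eq_add (⟨a, ha⟩ : {x : P // D.rk x = l}) ⟨b, hb⟩]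
    · rw [coeff_comp D F hxa hay, coeff_comp D F hxb hby, ← add_smul]
      have hbal := D.balanced x.1 a b y.1 hxa hay hxb hby hba.symm
      have h0 : ((D.sign x.1 a * D.sign a y.1 : ℤˣ) : ℤ) + ((D.sign x.1 b * D.sign b y.1 : ℤˣ) : ℤ)
          = 0 := by
        generalize D.sign x.1 a * D.sign a y.1 = s at hbal
        generalize D.sign x.1 b * D.sign b y.1 = t at hbal
        rcases Int.units_eq_one_or s with rfl | rfl <;>
          rcases Int.units_eq_one_or t with rfl | rfl <;> revert hbal <;> decide
      rw [h0, zero_smul]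
    · intro h
      exact hba (congrArg Subtype.val h).symm
    · rintro ⟨c, hc⟩ _ ⟨h1, h2⟩
      by_cases hxc : x.1 ⋖ c
      · by_cases hcy : c ⋖ y.1
        · rcases hall c hxc hcy with rfl | rfl
          · exact absurd rfl h1
          · exact absurd rfl h2
        · rw [coeff_not_covBy D F hcy]; rfl
      · rw [coeff_not_covBy D F hxc, LinearMap.zero_apply, map_zero]
    · intro h; exact absurd (Finset.mem_univ _) h
    · intro h; exact absurd (Finset.mem_univ _) h
  · refine Finset.sum_eq_zero fun a _ => ?_
    by_cases hxa : x.1 ⋖ a.1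
    · rw [coeff_not_covBy D F (fun h => hex ⟨a.1, hxa, h⟩)]; rfl
    · rw [coeff_not_covBy D F hxa, LinearMap.zero_apply, map_zero]

/-- The cochain complex `C^*(F, c)`. -/
def complex [Finite P] : CochainComplex (ModuleCat.{max p w} R) ℕ where
  X k := ModuleCat.of R (D.Cochain F k)
  d k l := ModuleCat.ofHom (D.diff F k l)
  shape k l h := by rw [diff_shape D F k l h]; rfl
  d_comp_d' k l m _ _ := by
    rw [← ModuleCat.ofHom_comp, diff_comp]; rfl

/-- The cohomology `H^i(F)` of a functor `F` from a thin poset to graded `R`-modules, as a graded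
`R`-module. Morphisms of graded modules preserve degrees, so cohomology is taken degree by
degree. -/
def cohomology [Finite P] (F : P ⥤ GradedObject ℤ (ModuleCat.{max p w} R)) (i : ℕ) :
    GradedObject ℤ (ModuleCat.{max p w} R) :=
  fun j => (D.complex (F ⋙ GradedObject.eval j)).homology i

end BalancedThin

/-- The inclusion of a subset of a poset, as a functor. -/
def inclFunctor {P : Type*} [PartialOrder P] (I : Set P) : I ⥤ P :=
  (Subtype.mono_coe (· ∈ I)).functor

/-! ### The Boolean lattice -/

/-- The Boolean lattice `2^E` on `E = {e_1, …, e_m}`, ranked by cardinality, with the balanced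
coloring `c(S ⋖ S + e_i) = (-1)^{#{j ∈ S | j < i}}`. -/
def booleanThin {E : Type*} {m : ℕ} (e : Fin m ≃ E) : BalancedThin (Finset E) := by
  classical
  exact
  { rk := Finset.card
    rk_covBy := fun S T h => by
      obtain ⟨a, ha, rfl⟩ := Finset.covBy_iff_exists_insert.1 h
      exact Finset.card_insert_of_notMem ha
    thin := fun S T h hr => by
      rw [← Finset.coe_Icc, Set.ncard_coe_finset, Finset.card_Icc_finset h, hr]
      simp
    sign := fun S T => (-1) ^ (S.filter fun f => ∃ g ∈ T, g ∉ S ∧ e.symm f < e.symm g).card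
    balanced := by
      have key : ∀ (S : Finset E) (a : E), a ∉ S →
          (S.filter fun f => ∃ g ∈ insert a S, g ∉ S ∧ e.symm f < e.symm g)
            = S.filter fun f => e.symm f < e.symm a := by
        intro S a ha
        refine Finset.filter_congr fun f _ => ⟨?_, fun h => ⟨a, by simp, ha, h⟩⟩
        rintro ⟨g, hg, hgS, hlt⟩
        rcases Finset.mem_insert.1 hg with rfl | hg
        · exact hlt
        · exact absurd hg hgS
      have main : ∀ (S : Finset E) (a b : E), a ∉ S → b ∉ S → e.symm a < e.symm b →
          (-1 : ℤˣ) ^ (S.filter fun f => e.symm f < e.symm a).card *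
            (-1) ^ ((insert a S).filter fun f => e.symm f < e.symm b).card *
          ((-1) ^ (S.filter fun f => e.symm f < e.symm b).card *
            (-1) ^ ((insert b S).filter fun f => e.symm f < e.symm a).card) = -1 := by
        intro S a b ha hb hab
        rw [Finset.filter_insert, if_pos hab, Finset.filter_insert, if_neg (not_lt.2 hab.le),
          Finset.card_insert_of_notMem (by simp [ha]), ← pow_add, ← pow_add, ← pow_add]
        generalize (S.filter fun f => e.symm f < e.symm a).card = p
        generalize (S.filter fun f => e.symm f < e.symm b).card = q
        exact Odd.neg_one_pow ⟨p + q, by ring⟩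
      intro S A B T hSA hAT hSB hBT hAB
      obtain ⟨a, ha, rfl⟩ := Finset.covBy_iff_exists_insert.1 hSA
      obtain ⟨b, hb, rfl⟩ := Finset.covBy_iff_exists_insert.1 hSB
      have hab : a ≠ b := fun h => hAB (by rw [h])
      have hT : T = insert b (insert a S) := by
        symm
        refine Finset.eq_of_subset_of_card_le ?_ ?_
        · refine Finset.insert_subset (hBT.le (Finset.mem_insert_self _ _)) hAT.le
        · obtain ⟨x, hx, rfl⟩ := Finset.covBy_iff_exists_insert.1 hAT
          rw [Finset.card_insert_of_notMem hx, Finset.card_insert_of_notMem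
            (show b ∉ insert a S by simp [hb, hab.symm])]
      subst hT
      have hba : b ∉ insert a S := by simp [hb, hab.symm]
      have hab' : a ∉ insert b S := by simp [ha, hab]
      rw [key S a ha, key S b hb, key _ b hba, Finset.insert_comm b a S, key _ a hab']
      have hne : e.symm a ≠ e.symm b := fun h => hab (e.symm.injective h)
      rcases lt_or_gt_of_ne hne with h | h
      · exact main S a b ha hb h
      · rw [mul_comm]
        exact main S b a hb ha h }

/-! ### Broken circuits -/

section Graph

universe v

variable {V : Type v} {G : SimpleGraph V}

/-- The spanning subgraph with vertex set `V` and edge set `S`. -/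
def spanningSubgraph (S : Finset G.edgeSet) : SimpleGraph V :=
  SimpleGraph.fromEdgeSet (Subtype.val '' (S : Set G.edgeSet))

lemma spanningSubgraph_mono {S T : Finset G.edgeSet} (h : S ≤ T) :
    spanningSubgraph S ≤ spanningSubgraph T :=
  SimpleGraph.fromEdgeSet_mono (Set.image_mono (Finset.coe_subset.2 h))

/-- The set of connected components of the spanning subgraph `S`. -/
abbrev Comp (S : Finset G.edgeSet) : Type v := (spanningSubgraph S).ConnectedComponent

/-- The number `k(S)` of connected components of the spanning subgraph `S`. -/
def numComp (S : Finset G.edgeSet) : ℕ := Nat.card (Comp S)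

/-- Every component of `S` lies in a unique component of `T ⊇ S`. -/
def compMap {S T : Finset G.edgeSet} (h : S ≤ T) : Comp S → Comp T :=
  SimpleGraph.ConnectedComponent.map (SimpleGraph.Hom.ofLE (spanningSubgraph_mono h))

/-- `B` is a broken circuit: the edge set of a cycle, with its largest edge `f` removed. -/
def IsBrokenCircuit {m : ℕ} (e : Fin m ≃ G.edgeSet) (B : Finset G.edgeSet) : Prop :=
  ∃ (x : V) (c : G.Walk x x) (f : G.edgeSet), c.IsCycle ∧ f.1 ∈ c.edges ∧
    (∀ g : G.edgeSet, g.1 ∈ c.edges → e.symm g ≤ e.symm f) ∧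
    ∀ g : G.edgeSet, g ∈ B ↔ g.1 ∈ c.edges ∧ g ≠ f

/-- The sets of edges that contain no broken circuit. -/
def NBC {m : ℕ} (e : Fin m ≃ G.edgeSet) : Set (Finset G.edgeSet) :=
  {S | ∀ B, IsBrokenCircuit e B → ¬ B ⊆ S}

lemma isLowerSet_NBC {m : ℕ} (e : Fin m ≃ G.edgeSet) : IsLowerSet (NBC e) :=
  fun _ _ hle hS B hB hBT => hS B hB (hBT.trans hle)

end Graph

/-! ### The chromatic functor -/

section Tensor

universe a u

variable (R : Type u) [CommRing R] {A : Type a} [CommRing A] [Algebra R A]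

open Classical in
/-- For `f : I → J`, the linear map `A^{⊗ I} → A^{⊗ J}` that multiplies, for each `j`, the tensor
factors with index in `f⁻¹(j)`, see `mulAlong_tprod`. -/
def mulAlong {I J : Type*} [Finite I] [Finite J] (f : I → J) :
    (⨂[R] _ : I, A) →ₗ[R] (⨂[R] _ : J, A) :=
  haveI := Fintype.ofFinite I
  PiTensorProduct.lift ((MultilinearMap.mkPiAlgebra R I (⨂[R] _ : J, A)).compLinearMap
    fun i => (PiTensorProduct.singleAlgHom (R := R) (A := fun _ : J => A) (f i)).toLinearMap)

open Classical in
lemma mulAlong_tprod {I J : Type*} [Fintype I] [Finite J] (f : I → J) (x : I → A) :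
    mulAlong R f (PiTensorProduct.tprod R x)
      = PiTensorProduct.tprod R fun j => ∏ i with f i = j, x i := by
  have h : ∀ i, PiTensorProduct.singleAlgHom (R := R) (A := fun _ : J => A) (f i) (x i)
      = PiTensorProduct.tprod R (Pi.mulSingle (f i) (x i)) := fun i => rfl
  simp only [mulAlong, PiTensorProduct.lift.tprod, MultilinearMap.compLinearMap_apply,
    MultilinearMap.mkPiAlgebra_apply, AlgHom.toLinearMap_apply, h]
  rw [Subsingleton.elim (Fintype.ofFinite I) ‹Fintype I›]
  refine (PiTensorProduct.tprod_prod (R := R) (A := fun _ : J => A) Finset.univ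
    fun i => Pi.mulSingle (f i) (x i)).symm.trans ?_
  congr 1
  ext j
  rw [Finset.prod_apply, Finset.prod_filter]
  refine Finset.prod_congr rfl fun i _ => ?_
  by_cases hij : f i = j
  · subst hij; simp
  · rw [if_neg hij, Pi.mulSingle_eq_of_ne (Ne.symm hij)]

variable (𝒜 : ℤ → Submodule R A)

/-- The part of degree `j` of `A^{⊗ I}`: the span of the tensors `⊗ xᵢ` of homogeneous elements
whose degrees add up to `j`. -/
def tensorDegree (I : Type*) [Finite I] (j : ℤ) : Submodule R (⨂[R] _ : I, A) :=
  Submodule.span R {t | ∃ (d : I → ℤ) (x : I → A), (∀ i, x i ∈ 𝒜 (d i)) ∧ ∑ᶠ i, d i = j ∧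
    PiTensorProduct.tprod R x = t}

lemma mulAlong_mem [GradedAlgebra 𝒜] {I J : Type*} [Finite I] [Finite J] (f : I → J) (j : ℤ)
    (t : ⨂[R] _ : I, A) (ht : t ∈ tensorDegree R 𝒜 I j) :
    mulAlong R f t ∈ tensorDegree R 𝒜 J j := by
  classical
  let _ := Fintype.ofFinite I
  let _ := Fintype.ofFinite J
  have : tensorDegree R 𝒜 I j ≤ (tensorDegree R 𝒜 J j).comap (mulAlong R f) := by
    refine Submodule.span_le.2 ?_
    rintro _ ⟨d, x, hx, hd, rfl⟩
    refine Submodule.subset_span ⟨fun k => ∑ i with f i = k, d i, fun k => ∏ i with f i = k, x i,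
      fun k => SetLike.prod_mem_graded 𝒜 _ _ fun i _ => hx i, ?_, ?_⟩
    · rw [← hd, finsum_eq_sum_of_fintype, finsum_eq_sum_of_fintype]
      exact Finset.sum_fiberwise _ _ _
    · rw [mulAlong_tprod]
  exact this ht

lemma mulAlong_id {I : Type*} [Finite I] :
    mulAlong R (A := A) (id : I → I) = LinearMap.id := by
  classical
  let _ := Fintype.ofFinite I
  ext x
  simp only [LinearMap.compMultilinearMap_apply, mulAlong_tprod, LinearMap.id_apply]
  congr 1
  ext j
  simp [Finset.prod_filter]

lemma mulAlong_comp {I J K : Type*} [Finite I] [Finite J] [Finite K] (f : I → J) (g : J → K) :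
    mulAlong R (A := A) (g ∘ f) = mulAlong R g ∘ₗ mulAlong R f := by
  classical
  let _ := Fintype.ofFinite I
  let _ := Fintype.ofFinite J
  ext x
  simp only [LinearMap.compMultilinearMap_apply, LinearMap.comp_apply, mulAlong_tprod]
  congr 1
  ext k
  rw [Finset.prod_filter, Finset.prod_filter, ← Finset.prod_fiberwise (Finset.univ) f]
  refine Finset.prod_congr rfl fun j _ => ?_
  split_ifs with h
  · refine Finset.prod_congr rfl fun i hi => ?_
    rw [if_pos (by simp [(Finset.mem_filter.1 hi).2, h])]
  · refine Finset.prod_eq_one fun i hi => ?_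
    rw [if_neg (by simp [(Finset.mem_filter.1 hi).2, h])]

end Tensor

section Functor

universe v u a

variable {V : Type v} [Finite V] (G : SimpleGraph V) {R : Type u} [CommRing R] {A : Type a}
  [CommRing A] [Algebra R A] (𝒜 : ℤ → Submodule R A) [GradedAlgebra 𝒜]

/-- The chromatic functor `2^E → (graded R-modules)`: it sends `S` to `A^{⊗ k(S)}`, with one tensor
factor for each connected component of `S`, and `S ⊆ T` to the map that multiplies the tensor
factors of the components of `S` that lie in the same component of `T`. For `T = S + e` this
multiplies two factors if `e` joins two components of `S`, and it is the identity otherwise. -/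
def chromaticFunctor :
    Finset G.edgeSet ⥤ GradedObject ℤ (ModuleCat.{max v u a} R) where
  obj S j := ModuleCat.of R (tensorDegree R 𝒜 (Comp S) j)
  map {S T} h j := ModuleCat.ofHom
    ((mulAlong R (compMap (leOfHom h))).restrict (mulAlong_mem R 𝒜 (compMap (leOfHom h)) j))
  map_id S := by
    funext j
    ext t
    have hid : compMap (leOfHom (𝟙 S)) = (id : Comp S → Comp S) := by
      funext C
      exact SimpleGraph.ConnectedComponent.map_id C
    change mulAlong R (compMap (leOfHom (𝟙 S))) t.1 = t.1
    rw [hid, mulAlong_id]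
    rfl
  map_comp {S T U} f g := by
    funext j
    ext t
    have hc : compMap (leOfHom (f ≫ g)) = compMap (leOfHom g) ∘ compMap (leOfHom f) := by
      funext C
      exact (SimpleGraph.ConnectedComponent.map_comp C
        (SimpleGraph.Hom.ofLE (spanningSubgraph_mono (leOfHom f)))
        (SimpleGraph.Hom.ofLE (spanningSubgraph_mono (leOfHom g)))).symm
    change mulAlong R (compMap (leOfHom (f ≫ g))) t.1 =
      mulAlong R (compMap (leOfHom g)) (mulAlong R (compMap (leOfHom f)) t.1)
    rw [hc, mulAlong_comp]
    rfl

variable {G}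

/-- Chromatic homology: the cohomology of the chromatic functor on the Boolean lattice `2^E`. -/
def chromaticHomology {m : ℕ} (e : Fin m ≃ G.edgeSet) (i : ℕ) :
    GradedObject ℤ (ModuleCat.{max v u a} R) :=
  (booleanThin e).cohomology (chromaticFunctor G 𝒜) i

/-- The cohomology of the restriction of the chromatic functor (and of the coloring) to `NBC`. -/
def chromaticHomologyNBC {m : ℕ} (e : Fin m ≃ G.edgeSet) (i : ℕ) :
    GradedObject ℤ (ModuleCat.{max v u a} R) :=
  ((booleanThin e).restrict (NBC e) (isLowerSet_NBC e)).cohomology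
    (inclFunctor (NBC e) ⋙ chromaticFunctor G 𝒜) i

end Functor

/-! ### Graded Euler characteristics -/

section Euler

universe w u

variable {R : Type u} [CommRing R]

open LaurentPolynomial in
/-- The graded rank `∑_j rk(M_j) q^j`. -/
def gradedRank (M : GradedObject ℤ (ModuleCat.{w} R)) : LaurentPolynomial ℤ :=
  ∑ᶠ j : ℤ, (Module.finrank R (M j) : ℤ) • (T j : LaurentPolynomial ℤ)

/-- The graded Euler characteristic `∑_i (-1)^i (∑_j rk(H^i_j) q^j)`. -/
def gradedEulerChar (H : ℕ → GradedObject ℤ (ModuleCat.{w} R)) : LaurentPolynomial ℤ :=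
  ∑ᶠ i : ℕ, (-1) ^ i * gradedRank (H i)

/-- Finitely generated bigraded modules: all pieces are finitely generated, and all but finitely
many of them vanish. -/
def IsFinitelyGenerated (H : ℕ → GradedObject ℤ (ModuleCat.{w} R)) : Prop :=
  (∀ i j, Module.Finite R (H i j)) ∧ {ij : ℕ × ℤ | Nontrivial (H ij.1 ij.2)}.Finite

end Euler

end

/-!
Call an edge `f` *active* for a set of edges `S` if its endpoints are connected by edges of `S` that
precede `f`. A path of earlier edges between the endpoints of `f` is a cycle with its largest edge
`f` removed, so `S` contains a broken circuit exactly if it has an active edge (`mem_NBC_iff`).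
Adding an active edge to `S`, or removing it, does not change which edges are active
(`isActive_insert_iff`, `isActive_erase_iff`). Toggling the largest active edge is therefore an
involution of the sets that contain a broken circuit; it changes the cardinality by one and keeps
the connected components.

For polynomials this means that the terms of `∑_{S ∈ BC} (-1)^{|S|} x^{k(S)}` cancel in pairs. For
homology it means that the chromatic functor inverts the matched cover relations
(`chromaticFunctor_map_bijective`). The largest active edge is monotone in `S`, so it filters the
subcomplex of cochains supported on `BC`. On each layer of the filtration the differential is
triangular with invertible matched entries, and the subcomplex is acyclic
(`BalancedThin.exists_diff_eq_of_matching`). Hence restriction of cochains from `2^E` to `NBC`, whose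
kernel is this subcomplex, induces an isomorphism in cohomology
(`BalancedThin.nonempty_homology_iso_restrict`).

The sum over all spanning subgraphs counts proper colorings by inclusion-exclusion over the
monochromatic edges (`eval_chromaticPolynomial`). For the graded Euler characteristics, a homogeneous
basis of `A` induces a homogeneous basis of each tensor power, so that graded ranks are
multiplicative (`gradedRank_tensorDegree`), and the Euler characteristic of a bounded complex of
finitely generated modules over a Noetherian domain equals that of its cohomology
(`CochainComplex.sum_neg_one_pow_finrank_homology`).
-/

noncomputable section

/-! ### Matchings on thin posets and acyclicity -/

/-- The homology of two complexes of modules agrees if there is a surjective map between them whose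
kernel is acyclic. Acyclicity of the kernel is stated on elements; in `K.d j k y = z` the degree `j`
is arbitrary, as `K.d j k` vanishes unless `j` precedes `k`. -/
theorem HomologicalComplex.nonempty_homology_iso_of_surjective {R : Type*} [Ring R] {ι : Type*}
    {c : ComplexShape ι} {K L : HomologicalComplex (ModuleCat R) c} (φ : K ⟶ L)
    (hs : ∀ i, Function.Surjective (φ.f i).hom)
    (hk : ∀ k (z : K.X k), (∀ l, (K.d k l).hom z = 0) → (φ.f k).hom z = 0 →
      ∃ (j : ι) (y : K.X j), (φ.f j).hom y = 0 ∧ (K.d j k).hom y = z) (i : ι) :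
    Nonempty (K.homology i ≅ L.homology i) := by
  have comm : ∀ i j (x : K.X i), (L.d i j).hom ((φ.f i).hom x) = (φ.f j).hom ((K.d i j).hom x) :=
    fun i j x => congr($(φ.comm i j).hom x)
  have dd : ∀ (M : HomologicalComplex (ModuleCat R) c) i j k (x : M.X i),
      (M.d j k).hom ((M.d i j).hom x) = 0 := fun M i j k x => congr($(M.d_comp_d i j k).hom x)
  have cyc : ∀ (M : HomologicalComplex (ModuleCat R) c) (x : M.X i),
      (M.d i (c.next i)).hom x = 0 → ∀ l, (M.d i l).hom x = 0 := by
    intro M x hx l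
    by_cases hl : c.Rel i l
    · rw [← c.next_eq' hl]; exact hx
    · rw [M.shape _ _ hl]; rfl
  let q : LinearMap.ker (K.sc i).g.hom →ₗ[R] LinearMap.ker (L.sc i).g.hom :=
    (φ.f i).hom.restrict fun x (hx : (K.d i (c.next i)).hom x = 0) => by
      change (L.d i (c.next i)).hom ((φ.f i).hom x) = 0
      rw [comm, hx, map_zero]
  -- `ψ` sends a cycle `z` of `K` to the homology class of `φ z`
  let ψ := (LinearMap.range (L.sc i).moduleCatToCycles).mkQ ∘ₗ q
  have hψs : Function.Surjective ψ := by
    refine (Submodule.mkQ_surjective _).comp ?_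
    rintro ⟨w, hw⟩
    obtain ⟨z, rfl⟩ := hs i w
    have h1 : (φ.f (c.next i)).hom ((K.d i (c.next i)).hom z) = 0 := (comm _ _ _).symm.trans hw
    obtain ⟨j, y, hy, hyz⟩ := hk _ _ (fun l => dd K _ _ _ _) h1
    have : ∃ y' : K.X i, (φ.f i).hom y' = 0 ∧
        (K.d i (c.next i)).hom y' = (K.d i (c.next i)).hom z := by
      by_cases hi : c.Rel i (c.next i)
      · by_cases hj : c.Rel j (c.next i)
        · obtain rfl := c.prev_eq hj hi
          exact ⟨y, hy, hyz⟩
        · exact ⟨0, map_zero _, by rw [map_zero, ← hyz, K.shape _ _ hj]; rfl⟩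
      · exact ⟨0, map_zero _, by rw [map_zero, K.shape _ _ hi]; rfl⟩
    obtain ⟨y', hy', hyz'⟩ := this
    refine ⟨⟨z - y', ?_⟩, Subtype.ext ?_⟩
    · change (K.d i (c.next i)).hom (z - y') = 0
      rw [map_sub, hyz', sub_self]
    · change (φ.f i).hom (z - y') = (φ.f i).hom z
      rw [map_sub, hy', sub_zero]
  have hψk : LinearMap.range (K.sc i).moduleCatToCycles = LinearMap.ker ψ := by
    ext ⟨(z : K.X i), hz⟩
    rw [LinearMap.mem_ker, LinearMap.comp_apply, Submodule.mkQ_apply, Submodule.Quotient.mk_eq_zero]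
    constructor
    · rintro ⟨x, hx⟩
      refine ⟨(φ.f (c.prev i)).hom x, Subtype.ext ?_⟩
      refine (comm (c.prev i) i x).trans ?_
      rw [show (K.d (c.prev i) i).hom x = z from congrArg Subtype.val hx]
      rfl
    · rintro ⟨w, hw⟩
      obtain ⟨x, rfl⟩ := hs (c.prev i) w
      have hw' : (L.d (c.prev i) i).hom ((φ.f (c.prev i)).hom x) = (φ.f i).hom z :=
        congrArg Subtype.val hw
      obtain ⟨j, y, hy, hyz⟩ := hk i (z - (K.d (c.prev i) i).hom x)
        (fun l => by rw [map_sub, dd, sub_zero]; exact cyc K z hz l)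
        (by rw [map_sub, ← comm, hw', sub_self])
      have : ∃ x' : K.X (c.prev i), (K.d (c.prev i) i).hom x' = (K.d j i).hom y := by
        by_cases hj : c.Rel j i
        · obtain rfl := c.prev_eq' hj
          exact ⟨y, rfl⟩
        · exact ⟨0, by rw [map_zero, K.shape _ _ hj]; rfl⟩
      obtain ⟨x', hx'⟩ := this
      refine ⟨x + x', Subtype.ext ?_⟩
      change (K.d (c.prev i) i).hom (x + x') = z
      rw [map_add, hx', hyz, add_sub_cancel]
  exact ⟨(K.sc i).moduleCatHomologyIso ≪≫
    ((Submodule.quotEquivOfEq _ _ hψk).trans (ψ.quotKerEquivOfSurjective hψs)).toModuleIso ≪≫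
    (L.sc i).moduleCatHomologyIso.symm⟩

/-- A perfect matching `x ↔ partner x` by cover relations of the complement of the lower order ideal
`{lev = 0}`, filtered by the monotone map `lev`: matched elements have the same level, and if `x` is
the lower element of a matched pair, then every other element of the same level covered by
`partner x` is an upper element. The values of `partner` on the ideal are irrelevant. -/
structure FilteredMatching (P : Type*) [PartialOrder P] where
  lev : P → ℕ
  lev_mono : Monotone lev
  partner : P → P
  lev_partner : ∀ x, lev x ≠ 0 → lev (partner x) = lev x
  partner_partner : ∀ x, lev x ≠ 0 → partner (partner x) = x
  covBy_or : ∀ x, lev x ≠ 0 → x ⋖ partner x ∨ partner x ⋖ x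
  upper : ∀ x y, lev x ≠ 0 → x ⋖ partner x → y ⋖ partner x → lev y = lev x → y ≠ x →
    partner y ⋖ y

namespace BalancedThin

universe p w u

variable {P : Type p} [PartialOrder P] (D : BalancedThin P)
  {R : Type u} [CommRing R] (F : P ⥤ ModuleCat.{max p w} R)

lemma diff_apply [Finite P] (k l : ℕ) [inst : Fintype {x : P // D.rk x = k}] (f : D.Cochain F k)
    (y : {x : P // D.rk x = l}) :
    D.diff F k l f y = ∑ x : {x : P // D.rk x = k}, D.coeff F x.1 y.1 (f x) := by
  rw [Subsingleton.elim inst (Fintype.ofFinite _)]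
  simp [diff]

lemma coeff_bijective {x y : P} (h : x ⋖ y)
    (hF : Function.Bijective (F.map (homOfLE h.le)).hom) :
    Function.Bijective (D.coeff F x y) := by
  rw [coeff_covBy D F h]
  rcases Int.units_eq_one_or (D.sign x y) with hs | hs
  · simpa [hs] using hF
  · rw [hs, Units.val_neg, Units.val_one, neg_smul, one_smul]
    exact neg_involutive.bijective.comp hF

section Restrict

variable [Finite P] (I : Set P) (hI : IsLowerSet I)

/-- Restriction of cochains to a lower order ideal. -/
def restrictMap : D.complex F ⟶ (D.restrict I hI).complex (inclFunctor I ⋙ F) where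
  f k := ModuleCat.ofHom (LinearMap.pi fun x : {x : I // (D.restrict I hI).rk x = k} =>
    (LinearMap.proj (⟨x.1.1, x.2⟩ : {x : P // D.rk x = k}) : D.Cochain F k →ₗ[R] F.obj x.1.1))
  comm' k l _ := by
    ext z
    funext y
    let _ := Fintype.ofFinite {x : P // D.rk x = k}
    let _ := Fintype.ofFinite {x : I // (D.restrict I hI).rk x = k}
    change (D.restrict I hI).diff (inclFunctor I ⋙ F) k l (fun x => z ⟨x.1.1, x.2⟩) y
      = D.diff F k l z ⟨y.1.1, y.2⟩
    refine (diff_apply _ _ _ _ _ _).trans (Eq.trans ?_ (D.diff_apply F k l z ⟨y.1.1, y.2⟩).symm)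
    have hcov : ∀ x : I, x ⋖ y.1 ↔ (x : P) ⋖ (y.1 : P) := fun x =>
      ⟨fun h => ⟨h.1, fun a hxa hay => h.2 (c := ⟨a, hI hay.le y.1.2⟩) hxa hay⟩,
        fun h => ⟨h.1, fun _ hxa hay => h.2 hxa hay⟩⟩
    refine Finset.sum_of_injOn
      (fun x : {x : I // (D.restrict I hI).rk x = k} => (⟨x.1.1, x.2⟩ : {x : P // D.rk x = k}))
      ?_ (fun _ _ => Finset.mem_coe.2 (Finset.mem_univ _)) ?_ ?_
    · intro a _ b _ hab
      exact Subtype.ext (Subtype.ext (congrArg (fun t => t.1) hab))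
    · intro x _ hx
      have hc : ¬ x.1 ⋖ y.1.1 := fun h =>
        hx ⟨⟨⟨x.1, hI h.le y.1.2⟩, x.2⟩, Finset.mem_coe.2 (Finset.mem_univ _), rfl⟩
      rw [coeff_not_covBy D F hc, LinearMap.zero_apply]
      rfl
    · intro x _
      by_cases h : x.1 ⋖ y.1
      · rw [coeff_covBy _ _ h, coeff_covBy _ _ ((hcov _).1 h)]
        rfl
      · rw [coeff_not_covBy _ _ h, coeff_not_covBy _ _ (fun h' => h ((hcov _).2 h'))]
        rfl

lemma restrictMap_surjective (k : ℕ) :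
    Function.Surjective ((D.restrictMap F I hI).f k).hom := by
  classical
  intro w
  refine ⟨fun x : {x : P // D.rk x = k} => if h : x.1 ∈ I then
    (show (D.restrict I hI).Cochain (inclFunctor I ⋙ F) k from w) ⟨⟨x.1, h⟩, x.2⟩ else 0, ?_⟩
  funext x
  exact dif_pos x.1.2

end Restrict

section Matching

variable [Finite P] (M : FilteredMatching P)

/-- A cocycle of level at least `n` that vanishes on the upper elements of level `n` vanishes on
the lower elements of level `n`, too: evaluate the cocycle condition at their partners. -/
lemma apply_eq_zero_of_upper
    (hF : ∀ x (h : x ⋖ M.partner x), M.lev x ≠ 0 →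
      Function.Bijective (F.map (homOfLE h.le)).hom)
    {n k : ℕ} (hn : n ≠ 0) (z : D.Cochain F k) (hz : D.diff F k (k + 1) z = 0)
    (hsupp : ∀ x, M.lev x.1 < n → z x = 0)
    (hup : ∀ x, M.lev x.1 = n → M.partner x.1 ⋖ x.1 → z x = 0)
    (x : {x : P // D.rk x = k}) (hx : M.lev x.1 = n) : z x = 0 := by
  have hx0 : M.lev x.1 ≠ 0 := hx ▸ hn
  rcases M.covBy_or x.1 hx0 with h | h
  swap
  · exact hup x hx h
  let _ := Fintype.ofFinite {x : P // D.rk x = k}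
  have key := congrFun hz ⟨M.partner x.1, by rw [D.rk_covBy _ _ h, x.2]⟩
  rw [diff_apply, Finset.sum_eq_single x] at key
  · exact (D.coeff_bijective F h (hF x.1 h hx0)).1 (key.trans (map_zero _).symm)
  · intro y _ hyx
    by_cases hy : y.1 ⋖ M.partner x.1
    · have hle : M.lev y.1 ≤ n := by
        rw [← hx, ← M.lev_partner _ hx0]
        exact M.lev_mono hy.le
      have : z y = 0 := by
        rcases hle.lt_or_eq with hlt | heq
        · exact hsupp y hlt
        · exact hup y heq (M.upper x.1 y.1 hx0 h hy (heq.trans hx.symm)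
            (fun h' => hyx (Subtype.ext h')))
      rw [this, map_zero]
    · rw [coeff_not_covBy D F hy, LinearMap.zero_apply]
  · exact fun h' => absurd (Finset.mem_univ _) h'

/-- A cocycle of level at least `n` is cohomologous to one of level at least `n + 1`. -/
lemma exists_sub_diff_apply_eq_zero
    (hF : ∀ x (h : x ⋖ M.partner x), M.lev x ≠ 0 →
      Function.Bijective (F.map (homOfLE h.le)).hom)
    {n k : ℕ} (hn : n ≠ 0) (z : D.Cochain F (k + 1)) (hz : D.diff F (k + 1) (k + 2) z = 0)
    (hsupp : ∀ x, M.lev x.1 < n → z x = 0) :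
    ∃ y : D.Cochain F k, (∀ x, M.lev x.1 < n → y x = 0) ∧
      ∀ x, M.lev x.1 < n + 1 → (z - D.diff F k (k + 1) y) x = 0 := by
  classical
  -- on lower elements `x` of level `n`, pull `z (partner x)` back along `F(x ⋖ partner x)`
  have hy : ∀ x : {x : P // D.rk x = k}, ∃ v : F.obj x.1,
      (∀ w : {x : P // D.rk x = k + 1}, M.lev x.1 = n → x.1 ⋖ w.1 → w.1 = M.partner x.1 →
        D.coeff F x.1 w.1 v = z w) ∧
      (¬ (M.lev x.1 = n ∧ x.1 ⋖ M.partner x.1) → v = 0) := by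
    intro x
    by_cases h : M.lev x.1 = n ∧ x.1 ⋖ M.partner x.1
    · obtain ⟨v, hv⟩ := (D.coeff_bijective F h.2 (hF x.1 h.2 (h.1 ▸ hn))).2
        (z ⟨M.partner x.1, by rw [D.rk_covBy _ _ h.2, x.2]⟩)
      refine ⟨v, ?_, fun h' => absurd h h'⟩
      rintro ⟨w, hw⟩ _ _ rfl
      exact hv
    · refine ⟨0, fun w h1 h2 h3 => absurd ⟨h1, h3 ▸ h2⟩ h, fun _ => rfl⟩
  choose y hy1 hy2 using hy
  let _ := Fintype.ofFinite {x : P // D.rk x = k}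
  have hylow : ∀ x, M.lev x.1 < n → y x = 0 := fun x hx => hy2 x fun h => hx.ne h.1
  have hlow : ∀ x, M.lev x.1 < n → (z - D.diff F k (k + 1) y) x = 0 := by
    intro x hx
    rw [Pi.sub_apply, hsupp x hx, zero_sub, neg_eq_zero, diff_apply]
    refine Finset.sum_eq_zero fun x' _ => ?_
    by_cases hc : x'.1 ⋖ x.1
    · rw [hylow x' ((M.lev_mono hc.le).trans_lt hx), map_zero]
    · rw [coeff_not_covBy D F hc, LinearMap.zero_apply]
  refine ⟨y, hylow, fun x hx => ?_⟩
  rcases (Nat.lt_succ_iff.1 hx).lt_or_eq with hlt | heq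
  · exact hlow x hlt
  refine D.apply_eq_zero_of_upper F M hF hn _ ?_ hlow (fun x hx hc => ?_) x heq
  · rw [map_sub, hz, zero_sub, neg_eq_zero]
    exact LinearMap.congr_fun (D.diff_comp F _ _ _) y
  · have hx0 : M.lev x.1 ≠ 0 := hx ▸ hn
    have hpp := M.partner_partner _ hx0
    have hlp : M.lev (M.partner x.1) = n := (M.lev_partner _ hx0).trans hx
    have hrk : D.rk (M.partner x.1) = k := by
      have := D.rk_covBy _ _ hc
      rw [x.2] at this
      exact (Nat.succ_injective this).symm
    rw [Pi.sub_apply, sub_eq_zero, diff_apply, Finset.sum_eq_single ⟨M.partner x.1, hrk⟩]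
    · exact (hy1 ⟨M.partner x.1, hrk⟩ x hlp hc hpp.symm).symm
    · intro x' _ hne
      by_cases hc' : x'.1 ⋖ x.1
      · rw [hy2 x', map_zero]
        rintro ⟨h1, h2⟩
        have := M.upper (M.partner x.1) x'.1 (hlp ▸ hn) (by rwa [hpp]) (by rwa [hpp])
          (h1.trans hlp.symm) (fun h' => hne (Subtype.ext h'))
        exact (h2.lt.trans this.lt).false
      · rw [coeff_not_covBy D F hc', LinearMap.zero_apply]
    · exact fun h' => absurd (Finset.mem_univ _) h'

/-- The cochains supported on the matched elements form an acyclic complex. -/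
theorem exists_diff_eq_of_matching
    (hF : ∀ x (h : x ⋖ M.partner x), M.lev x ≠ 0 →
      Function.Bijective (F.map (homOfLE h.le)).hom)
    (k : ℕ) (z : D.Cochain F k) (hz : D.diff F k (k + 1) z = 0)
    (hsupp : ∀ x, M.lev x.1 = 0 → z x = 0) :
    ∃ (j : ℕ) (y : D.Cochain F j), (∀ x, M.lev x.1 = 0 → y x = 0) ∧ D.diff F j k y = z := by
  -- descending induction on the level, starting from a bound `N` of all levels
  obtain ⟨N, hN⟩ : ∃ N, ∀ x, M.lev x < N := by
    obtain ⟨N, hN⟩ := (Set.finite_range M.lev).bddAbove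
    exact ⟨N + 1, fun x => Nat.lt_succ_of_le (hN ⟨x, rfl⟩)⟩
  suffices h : ∀ d n, N ≤ n + d → n ≠ 0 → ∀ z : D.Cochain F k, D.diff F k (k + 1) z = 0 →
      (∀ x, M.lev x.1 < n → z x = 0) → ∃ (j : ℕ) (y : D.Cochain F j),
        (∀ x, M.lev x.1 < n → y x = 0) ∧ D.diff F j k y = z by
    obtain ⟨j, y, hy, hyz⟩ := h N 1 (by omega) one_ne_zero z hz
      fun x hx => hsupp x (Nat.lt_one_iff.1 hx)
    exact ⟨j, y, fun x hx => hy x (Nat.lt_one_iff.2 hx), hyz⟩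
  intro d
  induction d with
  | zero =>
    intro n hn _ z _ hs
    refine ⟨k, 0, fun _ _ => rfl, ?_⟩
    rw [map_zero]
    funext x
    exact (hs x ((hN x.1).trans_le hn)).symm
  | succ d ih =>
    intro n hn hn0 z hz hs
    cases k with
    | zero =>
      refine (ih (n + 1) (by omega) (by omega) z hz fun x hx => ?_).imp fun j hj =>
        hj.imp fun y hy => ⟨fun x hx => hy.1 x (by omega), hy.2⟩
      rcases (Nat.lt_succ_iff.1 hx).lt_or_eq with hlt | heq
      · exact hs x hlt
      · refine D.apply_eq_zero_of_upper F M hF hn0 z hz hs (fun x _ hc => ?_) x heq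
        have := D.rk_covBy _ _ hc
        rw [x.2] at this
        exact absurd this (by omega)
    | succ k =>
      obtain ⟨y, hy, hyz⟩ := D.exists_sub_diff_apply_eq_zero F M hF hn0 z hz hs
      obtain ⟨j, y', hy', hyz'⟩ := ih (n + 1) (by omega) (by omega) _ (by
        rw [map_sub, hz, zero_sub, neg_eq_zero]
        exact LinearMap.congr_fun (D.diff_comp F _ _ _) y) hyz
      by_cases hj : j = k
      · subst hj
        refine ⟨j, y' + y, fun x hx => ?_, ?_⟩
        · rw [Pi.add_apply, hy x hx, hy' x (by omega), add_zero]
        · rw [map_add, hyz', sub_add_cancel]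
      · refine ⟨k, y, hy, ?_⟩
        rw [D.diff_shape F j (k + 1) (by omega), LinearMap.zero_apply] at hyz'
        exact (sub_eq_zero.1 hyz'.symm).symm

/-- If `F` inverts the cover relations of a filtered matching, the matched elements can be removed
from the poset without changing the cohomology. -/
theorem nonempty_homology_iso_restrict (I : Set P) (hI : IsLowerSet I)
    (hIM : ∀ x, x ∈ I ↔ M.lev x = 0)
    (hF : ∀ x (h : x ⋖ M.partner x), M.lev x ≠ 0 →
      Function.Bijective (F.map (homOfLE h.le)).hom) (i : ℕ) :
    Nonempty ((D.complex F).homology i ≅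
      ((D.restrict I hI).complex (inclFunctor I ⋙ F)).homology i) := by
  have hker : ∀ k (z : D.Cochain F k), ((D.restrictMap F I hI).f k).hom z = 0 ↔
      ∀ x, M.lev x.1 = 0 → z x = 0 := fun k z =>
    ⟨fun h x hx => congrFun h ⟨⟨x.1, (hIM _).2 hx⟩, x.2⟩,
      fun h => funext fun x => h ⟨x.1.1, x.2⟩ ((hIM _).1 x.1.2)⟩
  refine HomologicalComplex.nonempty_homology_iso_of_surjective (D.restrictMap F I hI)
    (D.restrictMap_surjective F I hI) (fun k z hz hz0 => ?_) i
  obtain ⟨j, y, hy, hyz⟩ := D.exists_diff_eq_of_matching F M hF k z (hz (k + 1)) ((hker k z).1 hz0)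
  exact ⟨j, y, (hker j y).2 hy, hyz⟩

end Matching

end BalancedThin

/-! ### Broken circuits and activity -/

section Graph

universe v

variable {V : Type v} {G : SimpleGraph V}

lemma spanningSubgraph_adj {S : Finset G.edgeSet} {u v : V} :
    (spanningSubgraph S).Adj u v ↔ ∃ f ∈ S, f.1 = s(u, v) := by
  rw [spanningSubgraph, SimpleGraph.fromEdgeSet_adj]
  constructor
  · rintro ⟨⟨f, hf, h⟩, _⟩
    exact ⟨f, hf, h⟩
  · rintro ⟨f, hf, h⟩
    refine ⟨⟨f, hf, h⟩, SimpleGraph.Adj.ne (G := G) ?_⟩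
    rw [← SimpleGraph.mem_edgeSet, ← h]
    exact f.2

lemma mem_edgeSet_spanningSubgraph {S : Finset G.edgeSet} {s : Sym2 V} :
    s ∈ (spanningSubgraph S).edgeSet ↔ ∃ f ∈ S, f.1 = s := by
  induction s with
  | _ u v => rw [SimpleGraph.mem_edgeSet, spanningSubgraph_adj]

lemma spanningSubgraph_le (S : Finset G.edgeSet) : spanningSubgraph S ≤ G := by
  intro u v h
  obtain ⟨f, -, h⟩ := spanningSubgraph_adj.1 h
  rw [← SimpleGraph.mem_edgeSet, ← h]
  exact f.2

/-- The endpoints of `f` lie in the same component of `(V, S)`. -/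
def Spans (S : Finset G.edgeSet) (f : G.edgeSet) : Prop :=
  ∀ u v, f.1 = s(u, v) → (spanningSubgraph S).Reachable u v

lemma spans_iff {S : Finset G.edgeSet} {f : G.edgeSet} {u v : V} (hf : f.1 = s(u, v)) :
    Spans S f ↔ (spanningSubgraph S).Reachable u v := by
  refine ⟨fun h => h u v hf, fun h a b hab => ?_⟩
  rcases Sym2.eq_iff.1 (hf.symm.trans hab) with ⟨rfl, rfl⟩ | ⟨rfl, rfl⟩
  · exact h
  · exact h.symm

lemma Spans.mono {S T : Finset G.edgeSet} (hST : S ⊆ T) {f : G.edgeSet} (h : Spans S f) :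
    Spans T f :=
  fun u v huv => (h u v huv).mono (spanningSubgraph_mono hST)

/-- If each edge of `T` is spanned by `S`, then every component of `T` is contained in a component
of `S`. -/
lemma reachable_of_forall_spans {S T : Finset G.edgeSet} (h : ∀ f ∈ T, Spans S f) {u v : V}
    (huv : (spanningSubgraph T).Reachable u v) : (spanningSubgraph S).Reachable u v := by
  obtain ⟨w⟩ := huv
  induction w with
  | nil => exact .rfl
  | cons hadj _ ih =>
    obtain ⟨f, hf, hfe⟩ := spanningSubgraph_adj.1 hadj
    exact (h f hf _ _ hfe).trans ih

lemma spans_of_mem {S : Finset G.edgeSet} {f : G.edgeSet} (hf : f ∈ S) : Spans S f :=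
  fun _ _ h => (spanningSubgraph_adj.2 ⟨f, hf, h⟩).reachable

lemma compMap_bijective {S T : Finset G.edgeSet} (hST : S ≤ T) (h : ∀ f ∈ T, Spans S f) :
    Function.Bijective (compMap hST) := by
  constructor
  · intro C D
    induction C using SimpleGraph.ConnectedComponent.ind
    induction D using SimpleGraph.ConnectedComponent.ind
    intro hCD
    exact SimpleGraph.ConnectedComponent.sound
      (reachable_of_forall_spans h (SimpleGraph.ConnectedComponent.exact hCD))
  · intro C
    induction C using SimpleGraph.ConnectedComponent.ind with
    | _ v => exact ⟨(spanningSubgraph S).connectedComponentMk v, rfl⟩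

variable {m : ℕ} (e : Fin m ≃ G.edgeSet)

open Classical in
/-- The edges of `S` that precede `f`. -/
def edgesBelow (S : Finset G.edgeSet) (f : G.edgeSet) : Finset G.edgeSet :=
  S.filter fun g => e.symm g < e.symm f

lemma mem_edgesBelow {S : Finset G.edgeSet} {f g : G.edgeSet} :
    g ∈ edgesBelow e S f ↔ g ∈ S ∧ e.symm g < e.symm f := by
  simp [edgesBelow]

/-- An edge `f` is active for `S` if its endpoints are connected by edges of `S` that precede `f`;
equivalently, `S` contains a broken circuit with missing edge `f`. The edge `f` itself may or may
not belong to `S`. -/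
def IsActive (S : Finset G.edgeSet) (f : G.edgeSet) : Prop :=
  Spans (edgesBelow e S f) f

variable {e}

lemma IsActive.mono {S T : Finset G.edgeSet} (hST : S ⊆ T) {f : G.edgeSet} (h : IsActive e S f) :
    IsActive e T f :=
  Spans.mono (fun g hg => by
    rw [mem_edgesBelow] at hg ⊢
    exact ⟨hST hg.1, hg.2⟩) h

lemma IsActive.spans {S : Finset G.edgeSet} {f : G.edgeSet} (h : IsActive e S f) : Spans S f :=
  Spans.mono (fun _ hg => ((mem_edgesBelow e).1 hg).1) h

open Classical in
/-- Adding an active edge does not change which edges are active. -/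
lemma isActive_insert_iff {S : Finset G.edgeSet} {f : G.edgeSet} (hf : IsActive e S f)
    (g : G.edgeSet) : IsActive e (insert f S) g ↔ IsActive e S g := by
  refine ⟨fun h => ?_, IsActive.mono (Finset.subset_insert _ _)⟩
  intro u v huv
  refine reachable_of_forall_spans (fun a ha => ?_) (h u v huv)
  rw [mem_edgesBelow, Finset.mem_insert] at ha
  rcases ha with ⟨rfl | ha, hag⟩
  · refine Spans.mono (fun b hb => ?_) hf
    rw [mem_edgesBelow] at hb ⊢
    exact ⟨hb.1, hb.2.trans hag⟩
  · exact spans_of_mem ((mem_edgesBelow e).2 ⟨ha, hag⟩)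

open Classical in
/-- Whether an edge is active for `S` does not depend on whether it belongs to `S`. -/
lemma isActive_erase_self_iff {S : Finset G.edgeSet} {f : G.edgeSet} :
    IsActive e (S.erase f) f ↔ IsActive e S f := by
  have : edgesBelow e (S.erase f) f = edgesBelow e S f := by
    ext g
    simp only [mem_edgesBelow, Finset.mem_erase]
    exact ⟨fun h => ⟨h.1.2, h.2⟩, fun h => ⟨⟨fun hgf => (hgf ▸ h.2).false, h.1⟩, h.2⟩⟩
  rw [IsActive, this, IsActive]

open Classical in
/-- Removing an active edge does not change which edges are active. -/
lemma isActive_erase_iff {S : Finset G.edgeSet} {f : G.edgeSet} (hf : IsActive e S f)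
    (g : G.edgeSet) : IsActive e (S.erase f) g ↔ IsActive e S g := by
  by_cases hfS : f ∈ S
  · rw [← isActive_insert_iff (isActive_erase_self_iff.2 hf), Finset.insert_erase hfS]
  · rw [Finset.erase_eq_of_notMem hfS]

/-- A broken circuit contained in `S` is the same as a path in `S` between the endpoints of a later
edge. -/
lemma mem_NBC_iff {S : Finset G.edgeSet} : S ∈ NBC e ↔ ∀ f, ¬ IsActive e S f := by
  classical
  constructor
  · rintro hS ⟨s, hs⟩ hact
    induction s with
    | _ u v =>
    set f : G.edgeSet := ⟨s(u, v), hs⟩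
    have hadj : (spanningSubgraph (insert f (edgesBelow e S f))).Adj u v :=
      spanningSubgraph_adj.2 ⟨f, Finset.mem_insert_self _ _, rfl⟩
    have hreach : ((spanningSubgraph (insert f (edgesBelow e S f))).deleteEdges
        {s(u, v)}).Reachable u v := by
      refine (hact u v rfl).mono fun a b hab => ?_
      obtain ⟨g, hg, hgab⟩ := spanningSubgraph_adj.1 hab
      rw [SimpleGraph.deleteEdges_adj, spanningSubgraph_adj]
      refine ⟨⟨g, Finset.mem_insert_of_mem hg, hgab⟩, fun h => ?_⟩
      rw [Set.mem_singleton_iff, ← hgab] at h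
      obtain rfl : g = f := Subtype.ext h
      exact ((mem_edgesBelow e).1 hg).2.false
    obtain ⟨x, c, hc, hfc⟩ :=
      SimpleGraph.adj_and_reachable_delete_edges_iff_exists_cycle.1 ⟨hadj, hreach⟩
    have hmem : ∀ g : G.edgeSet, g.1 ∈ c.edges → g = f ∨ g ∈ edgesBelow e S f := fun g hg => by
      obtain ⟨g', hg', h⟩ := mem_edgeSet_spanningSubgraph.1 (c.edges_subset_edgeSet hg)
      obtain rfl : g' = g := Subtype.ext h
      exact Finset.mem_insert.1 hg'
    have := Finite.of_equiv _ e
    have := Fintype.ofFinite G.edgeSet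
    refine hS (Finset.univ.filter fun g => g.1 ∈ c.edges ∧ g ≠ f)
      ⟨x, c.mapLe (spanningSubgraph_le _), f, hc.mapLe _, ?_, ?_, ?_⟩ ?_
    · rwa [SimpleGraph.Walk.edges_mapLe_eq_edges]
    · intro g hg
      rw [SimpleGraph.Walk.edges_mapLe_eq_edges] at hg
      rcases hmem g hg with rfl | h
      · exact le_rfl
      · exact ((mem_edgesBelow e).1 h).2.le
    · intro g
      rw [SimpleGraph.Walk.edges_mapLe_eq_edges]
      simp
    · intro g hg
      rw [Finset.mem_filter] at hg
      exact ((mem_edgesBelow e).1 ((hmem g hg.2.1).resolve_left hg.2.2)).1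
  · rintro hS B ⟨x, c, ⟨s, hs⟩, hc, hfc, hmax, hB⟩ hBS
    induction s with
    | _ u v =>
    set f : G.edgeSet := ⟨s(u, v), hs⟩
    refine hS f ((spans_iff (f := f) rfl).2 ?_)
    have hsub : ∀ a ∈ c.edges, a ∈ (spanningSubgraph (insert f B)).edgeSet := fun a ha => by
      rw [mem_edgeSet_spanningSubgraph]
      let g : G.edgeSet := ⟨a, c.edges_subset_edgeSet ha⟩
      refine ⟨g, ?_, rfl⟩
      by_cases hgf : g = f
      · exact Finset.mem_insert.2 (Or.inl hgf)
      · exact Finset.mem_insert_of_mem ((hB g).2 ⟨ha, hgf⟩)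
    have := (SimpleGraph.adj_and_reachable_delete_edges_iff_exists_cycle.2
      ⟨x, c.transfer _ hsub, hc.transfer hsub, by rwa [SimpleGraph.Walk.edges_transfer]⟩).2
    refine this.mono fun a b hab => ?_
    rw [SimpleGraph.deleteEdges_adj, spanningSubgraph_adj] at hab
    obtain ⟨⟨g, hg, hgab⟩, hne⟩ := hab
    rw [Set.mem_singleton_iff, ← hgab] at hne
    have hgB := (Finset.mem_insert.1 hg).resolve_left fun h => hne (congrArg Subtype.val h)
    have hgc := (hB g).1 hgB
    refine spanningSubgraph_adj.2 ⟨g, (mem_edgesBelow e).2 ⟨hBS hgB, ?_⟩, hgab⟩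
    exact lt_of_le_of_ne (hmax g hgc.1) fun h => hgc.2 (e.symm.injective h)

variable (e)

open Classical in
/-- The position in `{1, …, m}` of the largest active edge of `S`, or zero if `S` has no active
edge. -/
def activity (S : Finset G.edgeSet) : ℕ :=
  ({i : Fin m | IsActive e S (e i)} : Finset (Fin m)).sup fun i => (i : ℕ) + 1

open Classical in
lemma activity_mono : Monotone (activity e) := fun _ _ hST =>
  Finset.sup_mono fun i hi => by
    rw [Finset.mem_filter] at hi ⊢
    exact ⟨hi.1, hi.2.mono hST⟩

lemma activity_congr {S T : Finset G.edgeSet} (h : ∀ f, IsActive e S f ↔ IsActive e T f) :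
    activity e S = activity e T := by
  have : IsActive e S = IsActive e T := funext fun f => propext (h f)
  rw [activity, this, activity]

variable {e} in
lemma activity_eq_zero_iff {S : Finset G.edgeSet} : activity e S = 0 ↔ S ∈ NBC e := by
  rw [mem_NBC_iff, activity, ← Nat.bot_eq_zero, Finset.sup_eq_bot_iff]
  simp only [Finset.mem_filter, Finset.mem_univ, true_and, Nat.bot_eq_zero, Nat.succ_ne_zero,
    imp_false]
  exact ⟨fun h f => by simpa using h (e.symm f), fun h i => h (e i)⟩

variable {e} in
lemma exists_isActive_of_activity_ne_zero {S : Finset G.edgeSet} (h : activity e S ≠ 0) :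
    ∃ f, IsActive e S f ∧ activity e S = (e.symm f : ℕ) + 1 := by
  classical
  have hne : ({i : Fin m | IsActive e S (e i)} : Finset (Fin m)).Nonempty := by
    rw [Finset.nonempty_iff_ne_empty]
    intro h0
    exact h (by rw [activity, h0, Finset.sup_empty]; rfl)
  obtain ⟨i, hi, h⟩ := Finset.exists_mem_eq_sup _ hne fun i : Fin m => (i : ℕ) + 1
  exact ⟨e i, (Finset.mem_filter.1 hi).2, by rw [activity, h, Equiv.symm_apply_apply]⟩

open Classical in
/-- Add the largest active edge to `S`, or remove it; sets without broken circuits stay fixed. -/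
def toggle (S : Finset G.edgeSet) : Finset G.edgeSet :=
  if h : activity e S ≠ 0 then
    let f := (exists_isActive_of_activity_ne_zero h).choose
    if f ∈ S then S.erase f else insert f S
  else S

variable {e}

open Classical in
lemma toggle_eq {S : Finset G.edgeSet} {f : G.edgeSet} (h : activity e S = (e.symm f : ℕ) + 1) :
    toggle e S = if f ∈ S then S.erase f else insert f S := by
  have h0 : activity e S ≠ 0 := by omega
  have hf : (exists_isActive_of_activity_ne_zero h0).choose = f := by
    have := (exists_isActive_of_activity_ne_zero h0).choose_spec.2
    exact e.symm.injective (Fin.ext (by omega))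
  rw [toggle, dif_pos h0]
  simp only [hf]

lemma activity_toggle (S : Finset G.edgeSet) : activity e (toggle e S) = activity e S := by
  classical
  by_cases h : activity e S ≠ 0
  · obtain ⟨f, hf, hS⟩ := exists_isActive_of_activity_ne_zero h
    rw [toggle_eq hS]
    split_ifs
    · exact activity_congr e (isActive_erase_iff hf)
    · exact activity_congr e (isActive_insert_iff hf)
  · rw [toggle, dif_neg h]

lemma toggle_toggle (S : Finset G.edgeSet) : toggle e (toggle e S) = S := by
  classical
  by_cases h : activity e S ≠ 0
  · obtain ⟨f, hf, hS⟩ := exists_isActive_of_activity_ne_zero h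
    rw [toggle_eq ((activity_toggle S).trans hS), toggle_eq hS]
    by_cases hfS : f ∈ S
    · simp [hfS]
    · simp [hfS]
  · rw [toggle, dif_neg (by rwa [activity_toggle]), toggle, dif_neg h]

variable (e)

/-- Toggling the largest active edge is a perfect matching of the sets that contain a broken
circuit. -/
def toggleMatching : FilteredMatching (Finset G.edgeSet) where
  lev := activity e
  lev_mono := activity_mono e
  partner := toggle e
  lev_partner S _ := activity_toggle S
  partner_partner S _ := toggle_toggle S
  covBy_or S h := by
    classical
    obtain ⟨f, hf, hS⟩ := exists_isActive_of_activity_ne_zero h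
    rw [toggle_eq hS]
    split_ifs with hfS
    · exact Or.inr (Finset.erase_covBy hfS)
    · exact Or.inl (Finset.covBy_insert hfS)
  upper S T h hS hT hlev hne := by
    classical
    obtain ⟨f, hf, hSf⟩ := exists_isActive_of_activity_ne_zero h
    rw [toggle_eq hSf] at hS hT
    rw [toggle_eq (hlev.trans hSf)]
    split_ifs at hS hT with hfS
    · exact absurd (hS.lt.trans (Finset.erase_covBy hfS).lt) (lt_irrefl _)
    -- `T` arises from `insert f S` by removing an edge other than `f`
    · have hfT : f ∈ T := by
        by_contra hfT
        have hTS : T ⊆ S := fun g hg =>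
          (Finset.mem_insert.1 (hT.le hg)).resolve_left fun h => hfT (h ▸ hg)
        exact hT.2 (lt_of_le_of_ne hTS hne) (Finset.covBy_insert hfS).lt
      rw [if_pos hfT]
      exact Finset.erase_covBy hfT

variable {e}

lemma compMap_toggle_bijective {S : Finset G.edgeSet} (h : activity e S ≠ 0)
    (hS : S ≤ toggle e S) : Function.Bijective (compMap hS) := by
  classical
  refine compMap_bijective _ fun g hg => ?_
  obtain ⟨f, hf, hSf⟩ := exists_isActive_of_activity_ne_zero h
  rw [toggle_eq hSf] at hg
  split_ifs at hg with hfS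
  · exact spans_of_mem (Finset.mem_of_mem_erase hg)
  · rcases Finset.mem_insert.1 hg with rfl | hg
    · exact hf.spans
    · exact spans_of_mem hg

lemma numComp_toggle {S : Finset G.edgeSet} (h : activity e S ≠ 0) :
    numComp (toggle e S) = numComp S := by
  have key : ∀ T : Finset G.edgeSet, activity e T ≠ 0 → T ≤ toggle e T →
      numComp (toggle e T) = numComp T := fun T hT hle =>
    (Nat.card_congr (Equiv.ofBijective _ (compMap_toggle_bijective hT hle))).symm
  have hor : S ⋖ toggle e S ∨ toggle e S ⋖ S := (toggleMatching e).covBy_or S h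
  rcases hor with hS | hS
  · exact key S h hS.le
  · have := key (toggle e S) (by rwa [activity_toggle]) (by rw [toggle_toggle]; exact hS.le)
    rw [toggle_toggle] at this
    exact this.symm

lemma neg_one_pow_card_toggle {S : Finset G.edgeSet} (h : activity e S ≠ 0) {R : Type*} [Ring R] :
    (-1 : R) ^ (toggle e S).card = - (-1) ^ S.card := by
  rcases (toggleMatching e).covBy_or S h with hS | hS
  · rw [show (toggle e S).card = S.card + 1 from (booleanThin e).rk_covBy _ _ hS, pow_succ]
    simp
  · rw [show S.card = (toggle e S).card + 1 from (booleanThin e).rk_covBy _ _ hS, pow_succ]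
    simp

/-! ### Whitney's theorem -/

open Polynomial

lemma finsum_compl_NBC_eq_zero (e : Fin m ≃ G.edgeSet) :
    ∑ᶠ S ∈ (NBC e)ᶜ, (-1) ^ S.card * (X : ℤ[X]) ^ numComp S = 0 := by
  classical
  have := Finite.of_equiv _ e
  rw [finsum_mem_eq_finite_toFinset_sum _ (Set.toFinite _)]
  have hmem : ∀ S, S ∈ (Set.toFinite (NBC e)ᶜ).toFinset ↔ activity e S ≠ 0 := fun S => by
    rw [Set.Finite.mem_toFinset, Set.mem_compl_iff, ← activity_eq_zero_iff]
  refine Finset.sum_involution (fun S _ => toggle e S) ?_ ?_ ?_ ?_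
  · intro S hS
    rw [numComp_toggle ((hmem S).1 hS), neg_one_pow_card_toggle ((hmem S).1 hS)]
    ring
  · intro S hS _ heq
    rcases (toggleMatching e).covBy_or S ((hmem S).1 hS) with h | h
    · exact h.ne heq.symm
    · exact h.ne heq
  · intro S hS
    rw [hmem, activity_toggle]
    exact (hmem S).1 hS
  · exact fun S _ => toggle_toggle S

/-- The chromatic polynomial, as a sum over all spanning subgraphs. -/
def chromaticPolynomial (G : SimpleGraph V) : ℤ[X] :=
  ∑ᶠ S : Finset G.edgeSet, (-1) ^ S.card * (X : ℤ[X]) ^ numComp S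

/-- Whitney's broken circuit theorem. -/
theorem chromaticPolynomial_eq_finsum_NBC (e : Fin m ≃ G.edgeSet) :
    chromaticPolynomial G = ∑ᶠ S ∈ NBC e, (-1) ^ S.card * (X : ℤ[X]) ^ numComp S := by
  have := Finite.of_equiv _ e
  rw [chromaticPolynomial, ← finsum_mem_univ, ← Set.union_compl_self (NBC e),
    finsum_mem_union disjoint_compl_right (Set.toFinite _) (Set.toFinite _),
    finsum_compl_NBC_eq_zero, add_zero]

/-- Colorings that are constant on the components of `S` are colorings of the components. -/
lemma card_colorings_constant [Finite V] (S : Finset G.edgeSet) (n : ℕ) :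
    Nat.card {c : V → Fin n // ∀ f ∈ S, ∀ u v, f.1 = s(u, v) → c u = c v} = n ^ numComp S := by
  have : Finite (Comp S) := Quot.finite _
  have := Fintype.ofFinite (Comp S)
  let E : {c : V → Fin n // ∀ f ∈ S, ∀ u v, f.1 = s(u, v) → c u = c v} ≃ (Comp S → Fin n) :=
    { toFun := fun c C => Quot.lift c.1 (fun u v huv => by
        obtain ⟨w⟩ := huv
        induction w with
        | nil => rfl
        | cons hadj _ ih =>
          obtain ⟨f, hf, hfe⟩ := spanningSubgraph_adj.1 hadj
          exact (c.2 f hf _ _ hfe).trans ih) C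
      invFun := fun c => ⟨fun u => c ((spanningSubgraph S).connectedComponentMk u),
        fun f hf u v huv => congrArg c
          (SimpleGraph.ConnectedComponent.sound (spans_of_mem hf u v huv))⟩
      left_inv := fun c => rfl
      right_inv := fun c => by
        funext C
        induction C using SimpleGraph.ConnectedComponent.ind
        rfl }
  rw [Nat.card_congr E, Nat.card_fun, Nat.card_fin, numComp]

/-- Inclusion-exclusion over the sets of monochromatic edges. -/
theorem eval_chromaticPolynomial [Finite V] (n : ℕ) :
    (chromaticPolynomial G).eval (n : ℤ) = Nat.card (G.Coloring (Fin n)) := by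
  classical
  have := Fintype.ofFinite V
  have : Finite G.edgeSet := Subtype.finite
  have := Fintype.ofFinite G.edgeSet
  rw [chromaticPolynomial, finsum_eq_sum_of_fintype, eval_finsetSum]
  let mono : (V → Fin n) → Finset G.edgeSet := fun c => {f | ∀ u v, f.1 = s(u, v) → c u = c v}
  have h1 : ∀ S : Finset G.edgeSet, ((-1) ^ S.card * (X : ℤ[X]) ^ numComp S).eval (n : ℤ)
      = ∑ c : V → Fin n, if S ⊆ mono c then (-1 : ℤ) ^ S.card else 0 := by
    intro S
    have hcard := card_colorings_constant S n
    rw [Nat.card_eq_fintype_card, Fintype.card_subtype] at hcard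
    rw [← Finset.sum_filter, Finset.sum_const, nsmul_eq_mul, mul_comm]
    have : ({c | S ⊆ mono c} : Finset (V → Fin n)) =
        Finset.univ.filter fun c => ∀ f ∈ S, ∀ u v, f.1 = s(u, v) → c u = c v := by
      ext c
      simp [mono, Finset.subset_iff]
    rw [this, hcard]
    simp
  simp_rw [h1]
  rw [Finset.sum_comm]
  have h2 : ∀ c : V → Fin n, ∑ S : Finset G.edgeSet,
      (if S ⊆ mono c then (-1 : ℤ) ^ S.card else 0) = if mono c = ∅ then 1 else 0 := by
    intro c
    rw [← Finset.sum_powerset_neg_one_pow_card, ← Finset.sum_filter]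
    congr 1
    ext S
    simp
  simp_rw [h2]
  rw [Finset.sum_boole, ← Fintype.card_subtype, ← Nat.card_eq_fintype_card]
  congr 1
  refine Nat.card_congr
    { toFun := fun c => SimpleGraph.Coloring.mk c.1 fun {u v} huv heq => ?_
      invFun := fun c => ⟨c, ?_⟩
      left_inv := fun c => rfl
      right_inv := fun c => rfl }
  · have : (⟨s(u, v), huv⟩ : G.edgeSet) ∈ mono c.1 := by
      simp only [mono, Finset.mem_filter, Finset.mem_univ, true_and]
      intro a b hab
      rcases Sym2.eq_iff.1 hab with ⟨rfl, rfl⟩ | ⟨rfl, rfl⟩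
      · exact heq
      · exact heq.symm
    rw [c.2] at this
    exact absurd this (Finset.notMem_empty _)
  · refine Finset.eq_empty_of_forall_notMem ?_
    rintro ⟨s, hs⟩ hf
    induction s with
    | _ u v =>
    exact c.valid hs ((Finset.mem_filter.1 hf).2 u v rfl)

end Graph

/-! ### Graded ranks of tensor powers -/

section Rank

universe w u a

variable {R : Type u} [CommRing R]

open LaurentPolynomial

lemma gradedRank_congr {M : GradedObject ℤ (ModuleCat.{w} R)}
    {N : GradedObject ℤ (ModuleCat.{a} R)}
    (h : ∀ j, Module.finrank R (M j) = Module.finrank R (N j)) : gradedRank M = gradedRank N := by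
  simp only [gradedRank, h]

lemma gradedRank_eq_sum_of_subsingleton {M : GradedObject ℤ (ModuleCat.{w} R)} [Nontrivial R]
    {J : Finset ℤ} (h : ∀ j ∉ J, Subsingleton (M j)) :
    gradedRank M = ∑ j ∈ J, (Module.finrank R (M j) : ℤ) • (T j : LaurentPolynomial ℤ) := by
  refine finsum_eq_sum_of_support_subset _ fun j hj => ?_
  by_contra hJ
  have := h j hJ
  exact hj (by simp only [Module.finrank_zero_of_subsingleton, Nat.cast_zero, zero_smul])

/-- If `M` has a homogeneous basis with `i`-th degree `deg i`, its graded rank is `∑ q^{deg i}`. -/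
lemma gradedRank_eq_sum_T {M : GradedObject ℤ (ModuleCat.{w} R)} {κ : Type*} [Fintype κ]
    (deg : κ → ℤ) (h : ∀ j, Module.finrank R (M j) = Nat.card {i // deg i = j}) :
    gradedRank M = ∑ i, (T (deg i) : LaurentPolynomial ℤ) := by
  classical
  have hcard : ∀ j, Module.finrank R (M j) = ({i | deg i = j} : Finset κ).card := fun j => by
    rw [h, Nat.card_eq_fintype_card, Fintype.card_subtype]
  rw [gradedRank, finsum_eq_sum_of_support_subset (s := Finset.univ.image deg),
    ← Finset.sum_fiberwise_of_maps_to (s := Finset.univ) (t := Finset.univ.image deg) (g := deg)]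
  · refine Finset.sum_congr rfl fun j _ => ?_
    rw [Finset.sum_congr rfl (g := fun _ => (T j : LaurentPolynomial ℤ))
      (fun i hi => by rw [(Finset.mem_filter.1 hi).2]), Finset.sum_const, hcard, natCast_zsmul]
  · exact fun i hi => Finset.mem_image_of_mem _ hi
  · intro j hj
    by_contra hJ
    refine hj ?_
    have : ({i | deg i = j} : Finset κ) = ∅ := Finset.filter_eq_empty_iff.2 fun i _ hij =>
      hJ (hij ▸ Finset.mem_coe.2 (Finset.mem_image_of_mem _ (Finset.mem_univ i)))
    simp only [hcard, this, Finset.card_empty, Nat.cast_zero, zero_smul]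

lemma T_sum {ι : Type*} (s : Finset ι) (d : ι → ℤ) :
    (T (∑ i ∈ s, d i) : LaurentPolynomial ℤ) = ∏ i ∈ s, T (d i) := by
  classical
  induction s using Finset.induction_on with
  | empty => simp
  | insert i s hi ih => rw [Finset.sum_insert hi, Finset.prod_insert hi, T_add, ih]

variable {A : Type a} [CommRing A] [Algebra R A] (𝒜 : ℤ → Submodule R A) [GradedAlgebra 𝒜]

/-- The pure tensors of homogeneous basis elements whose degrees add up to `j` form a basis of the
part of degree `j` of `A^{⊗ I}`. -/
theorem exists_basis_tensorDegree {κ : ℤ → Type*} (b : ∀ j, Module.Basis (κ j) R (𝒜 j))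
    (I : Type*) [Finite I] (j : ℤ) :
    Nonempty (Module.Basis {p : I → Σ j, κ j // ∑ᶠ i, (p i).1 = j} R (tensorDegree R 𝒜 I j)) := by
  classical
  let _ := Fintype.ofFinite I
  have hdec := DirectSum.Decomposition.isInternal 𝒜
  let B := hdec.collectedBasis b
  let BT := Basis.piTensorProduct (ι := I) fun _ => B
  have hspan : Submodule.span R (BT '' {p | ∑ᶠ i, (p i).1 = j}) = tensorDegree R 𝒜 I j := by
    refine le_antisymm (Submodule.span_le.2 ?_) (Submodule.span_le.2 ?_)
    · rintro _ ⟨p, hp, rfl⟩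
      exact Submodule.subset_span ⟨fun i => (p i).1, fun i => B (p i),
        fun i => hdec.collectedBasis_mem b (p i), hp, (Basis.piTensorProduct_apply _ p).symm⟩
    · rintro _ ⟨d, x, hx, hd, rfl⟩
      refine BT.mem_span_image.2 fun p hp => ?_
      have hpd : ∀ i, (p i).1 = d i := by
        intro i
        by_contra hne
        refine Finsupp.mem_support_iff.1 (Finset.mem_coe.1 hp) ?_
        rw [Basis.piTensorProduct_repr_tprod_apply]
        exact Finset.prod_eq_zero (Finset.mem_univ i)
          (hdec.collectedBasis_repr_of_mem_ne b (Ne.symm hne) (hx i))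
      change ∑ᶠ i, (p i).1 = j
      rw [← hd]
      exact finsum_congr hpd
  rw [Set.image_eq_range] at hspan
  exact ⟨(Module.Basis.span (BT.linearIndependent.comp
    (Subtype.val : {p : I → Σ j, κ j // ∑ᶠ i, (p i).1 = j} → _) Subtype.val_injective)).map
      (LinearEquiv.ofEq _ _ hspan)⟩

/-- The index type of a homogeneous basis of `A`. -/
abbrev HomogeneousIndex [∀ j, Module.Free R (𝒜 j)] : Type a :=
  Σ j : ℤ, Module.Free.ChooseBasisIndex R (𝒜 j)

lemma finite_homogeneousIndex [Nontrivial R] [∀ j, Module.Free R (𝒜 j)] [Module.Finite R A] :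
    Finite (HomogeneousIndex 𝒜) := by
  classical
  exact Module.Finite.finite_basis ((DirectSum.Decomposition.isInternal 𝒜).collectedBasis
    fun j => Module.Free.chooseBasis R (𝒜 j))

instance [∀ j, Module.Free R (𝒜 j)] (I : Type*) [Finite I] (j : ℤ) :
    Module.Free R (tensorDegree R 𝒜 I j) :=
  Module.Free.of_basis (exists_basis_tensorDegree 𝒜 (fun j => Module.Free.chooseBasis R (𝒜 j)) I
    j).some

lemma finite_tensorDegree [Nontrivial R] [∀ j, Module.Free R (𝒜 j)] [Module.Finite R A]
    (I : Type*) [Finite I] (j : ℤ) : Module.Finite R (tensorDegree R 𝒜 I j) := by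
  have := finite_homogeneousIndex 𝒜
  exact Module.Finite.of_basis
    (exists_basis_tensorDegree 𝒜 (fun j => Module.Free.chooseBasis R (𝒜 j)) I j).some

/-- Only finitely many degrees of a tensor power of `A` are nonzero. -/
lemma exists_subsingleton_tensorDegree [Nontrivial R] [∀ j, Module.Free R (𝒜 j)]
    [Module.Finite R A] (I : Type*) [Finite I] :
    ∃ J : Finset ℤ, ∀ j ∉ J, Subsingleton (tensorDegree R 𝒜 I j) := by
  have := finite_homogeneousIndex 𝒜
  have hfin := Set.finite_range fun p : I → HomogeneousIndex 𝒜 => ∑ᶠ i, (p i).1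
  refine ⟨hfin.toFinset, fun j hj => ?_⟩
  have : IsEmpty {p : I → HomogeneousIndex 𝒜 // ∑ᶠ i, (p i).1 = j} :=
    ⟨fun p => hj (hfin.mem_toFinset.2 ⟨p.1, p.2⟩)⟩
  exact (exists_basis_tensorDegree 𝒜 (fun j => Module.Free.chooseBasis R (𝒜 j)) I
    j).some.repr.toEquiv.subsingleton

/-- Graded ranks are multiplicative on tensor powers. -/
theorem gradedRank_tensorDegree [Nontrivial R] [∀ j, Module.Free R (𝒜 j)] [Module.Finite R A]
    {I : Type*} [Finite I] {M : GradedObject ℤ (ModuleCat.{w} R)}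
    (hM : ∀ j, Module.finrank R (M j) = Module.finrank R (tensorDegree R 𝒜 I j)) :
    gradedRank M = (gradedRank fun j => ModuleCat.of R (𝒜 j)) ^ Nat.card I := by
  classical
  have := finite_homogeneousIndex 𝒜
  let _ := Fintype.ofFinite (HomogeneousIndex 𝒜)
  let _ := Fintype.ofFinite I
  have h1 : gradedRank (fun j => ModuleCat.of R (𝒜 j)) =
      ∑ s : HomogeneousIndex 𝒜, (T s.1 : LaurentPolynomial ℤ) := by
    refine gradedRank_eq_sum_T _ fun j => ?_
    change Module.finrank R (𝒜 j) = _
    rw [Module.finrank_eq_nat_card_basis (Module.Free.chooseBasis R (𝒜 j))]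
    exact (Nat.card_congr (Equiv.sigmaSubtype (β := fun j => Module.Free.ChooseBasisIndex R (𝒜 j))
      j)).symm
  have h2 : gradedRank M = ∑ p : I → HomogeneousIndex 𝒜, T (∑ i, (p i).1) := by
    refine gradedRank_eq_sum_T _ fun j => ?_
    rw [hM, Module.finrank_eq_nat_card_basis (exists_basis_tensorDegree 𝒜
      (fun j => Module.Free.chooseBasis R (𝒜 j)) I j).some]
    simp_rw [finsum_eq_sum_of_fintype]
  rw [h1, h2]
  simp_rw [T_sum]
  rw [Nat.card_eq_fintype_card, ← Finset.card_univ, ← Finset.prod_const, Finset.prod_univ_sum,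
    Fintype.piFinset_univ]

end Rank

/-! ### Euler characteristics -/

section EulerCharacteristic

universe p w u

variable {R : Type u} [CommRing R]

/-- The telescoping argument for Euler characteristics: `x`, `h`, `r` stand for the ranks of the
cochains, of the cohomology and of the differentials. -/
lemma sum_neg_one_pow_eq_of_rank_eq {x h r r' : ℕ → ℕ} (hx : ∀ i, h i + r' i + r i = x i)
    (hr : ∀ i, r' (i + 1) = r i) (h0 : r' 0 = 0) (n : ℕ) :
    ∑ i ∈ Finset.range n, (-1 : ℤ) ^ i * h i =
      ∑ i ∈ Finset.range n, (-1 : ℤ) ^ i * x i + (-1) ^ n * r' n := by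
  induction n with
  | zero => simp [h0]
  | succ n ih =>
    rw [Finset.sum_range_succ, Finset.sum_range_succ, ih, ← hx, hr]
    push_cast
    ring

lemma CategoryTheory.ShortComplex.finrank_homology_add [IsDomain R]
    (S : ShortComplex (ModuleCat.{w} R)) [Module.Finite R S.X₂] [IsNoetherianRing R] :
    Module.finrank R S.homology + Module.finrank R (LinearMap.range S.f.hom) +
      Module.finrank R (LinearMap.range S.g.hom) = Module.finrank R S.X₂ := by
  have hr : Module.finrank R (LinearMap.range S.moduleCatToCycles) =
      Module.finrank R (LinearMap.range S.f.hom) := by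
    have hle : LinearMap.range S.f.hom ≤ LinearMap.ker S.g.hom := by
      rintro _ ⟨x, rfl⟩
      exact S.moduleCat_zero_apply x
    refine Eq.trans ?_ (Submodule.comapSubtypeEquivOfLe hle).finrank_eq
    rw [← LinearMap.range_codRestrict (LinearMap.ker S.g.hom) S.f.hom S.moduleCat_zero_apply]
  rw [S.moduleCatHomologyIso.toLinearEquiv.finrank_eq, ← hr]
  change Module.finrank R (_ ⧸ LinearMap.range S.moduleCatToCycles) + _ + _ = _
  rw [Submodule.finrank_quotient_add_finrank,
    ← Submodule.finrank_quotient_add_finrank (LinearMap.ker S.g.hom),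
    S.g.hom.quotKerEquivRange.finrank_eq, add_comm]

/-- The Euler characteristic of a bounded complex of finitely generated modules over a Noetherian
domain is the Euler characteristic of its cohomology. -/
theorem CochainComplex.sum_neg_one_pow_finrank_homology [IsDomain R] [IsNoetherianRing R]
    (K : CochainComplex (ModuleCat.{w} R) ℕ) (hK : ∀ i, Module.Finite R (K.X i)) {n : ℕ}
    (hn : Subsingleton (K.X n)) :
    ∑ i ∈ Finset.range n, (-1 : ℤ) ^ i * Module.finrank R (K.homology i) =
      ∑ i ∈ Finset.range n, (-1 : ℤ) ^ i * Module.finrank R (K.X i) := by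
  have hf : ∀ i, Module.finrank R (K.homology i) +
      Module.finrank R (LinearMap.range (K.d ((ComplexShape.up ℕ).prev i) i).hom) +
      Module.finrank R (LinearMap.range (K.d i (i + 1)).hom) = Module.finrank R (K.X i) := by
    intro i
    have : Module.Finite R (K.sc i).X₂ := hK i
    rw [← CochainComplex.next ℕ i]
    exact (K.sc i).finrank_homology_add
  rw [sum_neg_one_pow_eq_of_rank_eq hf (fun i => ?_) ?_ n]
  · rw [Module.finrank_zero_of_subsingleton, Nat.cast_zero, mul_zero, add_zero]
  · rw [K.shape _ _ (by simp), ModuleCat.hom_zero, LinearMap.range_zero, finrank_bot]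
  · rw [CochainComplex.prev_nat_succ]

namespace BalancedThin

variable {P : Type p} [PartialOrder P] [Finite P] (D : BalancedThin P)

lemma finite_cohomology [IsNoetherianRing R] (F : P ⥤ GradedObject ℤ (ModuleCat.{max p w} R))
    (hF : ∀ x j, Module.Finite R (F.obj x j)) (i : ℕ) (j : ℤ) :
    Module.Finite R (D.cohomology F i j) := by
  have : ∀ x, Module.Finite R ((F ⋙ GradedObject.eval j).obj x) := fun x => hF x j
  have : Module.Finite R ((D.complex (F ⋙ GradedObject.eval j)).sc i).X₂ :=
    inferInstanceAs (Module.Finite R (D.Cochain (F ⋙ GradedObject.eval j) i))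
  have : Module.Finite R
      ((D.complex (F ⋙ GradedObject.eval j)).sc i).moduleCatLeftHomologyData.H :=
    inferInstanceAs (Module.Finite R (_ ⧸ LinearMap.range
      ((D.complex (F ⋙ GradedObject.eval j)).sc i).moduleCatToCycles))
  exact Module.Finite.equiv
    ((D.complex (F ⋙ GradedObject.eval j)).sc i).moduleCatHomologyIso.toLinearEquiv.symm

lemma subsingleton_cohomology (F : P ⥤ GradedObject ℤ (ModuleCat.{max p w} R)) {i : ℕ} {j : ℤ}
    (h : ∀ x, D.rk x = i → Subsingleton (F.obj x j)) : Subsingleton (D.cohomology F i j) := by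
  have : ∀ x : {x : P // D.rk x = i}, Subsingleton ((F ⋙ GradedObject.eval j).obj x.1) :=
    fun x => h x.1 x.2
  have : Subsingleton ((D.complex (F ⋙ GradedObject.eval j)).sc i).X₂ :=
    inferInstanceAs (Subsingleton (D.Cochain (F ⋙ GradedObject.eval j) i))
  have e := ((D.complex (F ⋙ GradedObject.eval j)).sc i).moduleCatHomologyIso.toLinearEquiv.toEquiv
  refine e.subsingleton_congr.2 ?_
  exact (Submodule.mkQ_surjective _).subsingleton

lemma isFinitelyGenerated_cohomology [IsNoetherianRing R]
    (F : P ⥤ GradedObject ℤ (ModuleCat.{max p w} R)) (hF : ∀ x j, Module.Finite R (F.obj x j))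
    {J : Finset ℤ} (hJ : ∀ x, ∀ j ∉ J, Subsingleton (F.obj x j)) :
    IsFinitelyGenerated (D.cohomology F) := by
  refine ⟨D.finite_cohomology F hF, ((Set.finite_range D.rk).prod J.finite_toSet).subset ?_⟩
  rintro ⟨i, j⟩ hij
  rw [Set.mem_ofPred_eq, ← not_subsingleton_iff_nontrivial] at hij
  refine ⟨?_, ?_⟩
  · by_contra hi
    exact hij (D.subsingleton_cohomology F fun x hx => absurd ⟨x, hx⟩ hi)
  · by_contra hj
    exact hij (D.subsingleton_cohomology F fun x _ => hJ x j hj)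

/-- In each degree, the Euler characteristic can be computed from the cochains. -/
theorem gradedEulerChar_cohomology [Fintype P] [IsDomain R] [IsNoetherianRing R]
    (F : P ⥤ GradedObject ℤ (ModuleCat.{max p w} R))
    (hfree : ∀ x j, Module.Free R (F.obj x j)) (hF : ∀ x j, Module.Finite R (F.obj x j))
    {J : Finset ℤ} (hJ : ∀ x, ∀ j ∉ J, Subsingleton (F.obj x j)) :
    gradedEulerChar (D.cohomology F) = ∑ x, (-1) ^ D.rk x * gradedRank (F.obj x) := by
  classical
  obtain ⟨N, hN⟩ : ∃ N, ∀ x, D.rk x < N := by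
    obtain ⟨N, hN⟩ := (Set.finite_range D.rk).bddAbove
    exact ⟨N + 1, fun x => Nat.lt_succ_of_le (hN ⟨x, rfl⟩)⟩
  have hrank : ∀ i, gradedRank (D.cohomology F i) = ∑ j ∈ J,
      (Module.finrank R (D.cohomology F i j) : ℤ) • (LaurentPolynomial.T j) := fun i =>
    gradedRank_eq_sum_of_subsingleton fun j hj =>
      D.subsingleton_cohomology F fun x _ => hJ x j hj
  have hzero : ∀ i, N ≤ i → gradedRank (D.cohomology F i) = 0 := fun i hi => by
    rw [gradedRank_eq_sum_of_subsingleton (J := ∅) fun j _ =>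
      D.subsingleton_cohomology F fun x hx => absurd (hN x) (by omega), Finset.sum_empty]
  -- the identity in a single degree
  have hj : ∀ j, ∑ i ∈ Finset.range N, (-1 : ℤ) ^ i * Module.finrank R (D.cohomology F i j) =
      ∑ x, (-1 : ℤ) ^ D.rk x * Module.finrank R (F.obj x j) := by
    intro j
    have hfree' : ∀ x, Module.Free R ((F ⋙ GradedObject.eval j).obj x) := fun x => hfree x j
    have hF' : ∀ x, Module.Finite R ((F ⋙ GradedObject.eval j).obj x) := fun x => hF x j
    have hempty : IsEmpty {x : P // D.rk x = N} := ⟨fun x => (hN x.1).ne x.2⟩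
    have := CochainComplex.sum_neg_one_pow_finrank_homology
      (D.complex (F ⋙ GradedObject.eval j)) (n := N)
      (fun i => inferInstanceAs (Module.Finite R (D.Cochain (F ⋙ GradedObject.eval j) i)))
      (inferInstanceAs (Subsingleton (D.Cochain (F ⋙ GradedObject.eval j) N)))
    refine this.trans ?_
    rw [← Finset.sum_fiberwise_of_maps_to (s := Finset.univ) (t := Finset.range N) (g := D.rk)
      fun x _ => Finset.mem_range.2 (hN x)]
    refine Finset.sum_congr rfl fun i _ => ?_
    have hX : Module.finrank R ((D.complex (F ⋙ GradedObject.eval j)).X i) =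
        ∑ x : {x : P // D.rk x = i}, Module.finrank R (F.obj x.1 j) :=
      Module.finrank_pi_fintype R (M := fun x : {x : P // D.rk x = i} =>
        (F ⋙ GradedObject.eval j).obj x.1)
    rw [hX, Nat.cast_sum, Finset.mul_sum, Finset.sum_subtype ({x | D.rk x = i} : Finset P)
      (p := fun x => D.rk x = i) (by simp)]
    exact Finset.sum_congr rfl fun x _ => by rw [x.2]
  have hgr : ∀ x, gradedRank (F.obj x) = ∑ j ∈ J,
      (Module.finrank R (F.obj x j) : ℤ) • (LaurentPolynomial.T j) := fun x =>
    gradedRank_eq_sum_of_subsingleton (hJ x)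
  rw [gradedEulerChar, finsum_eq_sum_of_support_subset (s := Finset.range N)]
  · simp_rw [hrank, hgr, Finset.mul_sum]
    rw [Finset.sum_comm, Finset.sum_comm (s := Finset.univ)]
    refine Finset.sum_congr rfl fun j _ => ?_
    have := congrArg (fun z : ℤ => z • (LaurentPolynomial.T j : LaurentPolynomial ℤ)) (hj j)
    simp only [Finset.sum_smul, mul_smul] at this
    simpa [zsmul_eq_mul] using this
  · intro i hi
    by_contra h
    refine hi ?_
    rw [Finset.coe_range, Set.mem_Iio, not_lt] at h
    simp only [hzero i h, mul_zero]

end BalancedThin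

end EulerCharacteristic

/-! ### The chromatic functor and broken circuits -/

section Chromatic

universe v u a

variable {V : Type v} [Finite V] {G : SimpleGraph V} {R : Type u} [CommRing R] {A : Type a}
  [CommRing A] [Algebra R A] (𝒜 : ℤ → Submodule R A) [GradedAlgebra 𝒜]

lemma chromaticFunctor_map_bijective {S T : Finset G.edgeSet} (h : S ⟶ T)
    (hST : Function.Bijective (compMap (leOfHom h))) (j : ℤ) :
    Function.Bijective (((chromaticFunctor G 𝒜).map h) j).hom := by
  let E := Equiv.ofBijective _ hST
  have h1 : ∀ t : ⨂[R] _ : Comp S, A,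
      mulAlong R E.symm (mulAlong R (compMap (leOfHom h)) t) = t := fun t => by
    rw [← LinearMap.comp_apply, ← mulAlong_comp,
      show E.symm ∘ compMap (leOfHom h) = id from E.symm_comp_self, mulAlong_id]
    rfl
  have h2 : ∀ t : ⨂[R] _ : Comp T, A,
      mulAlong R (compMap (leOfHom h)) (mulAlong R E.symm t) = t := fun t => by
    rw [← LinearMap.comp_apply, ← mulAlong_comp,
      show compMap (leOfHom h) ∘ E.symm = id from E.self_comp_symm, mulAlong_id]
    rfl
  constructor
  · intro s t hst
    refine Subtype.ext ((h1 s.1).symm.trans (Eq.trans ?_ (h1 t.1)))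
    exact congrArg (mulAlong R E.symm) (congrArg Subtype.val hst)
  · intro t
    exact ⟨⟨mulAlong R E.symm t.1, mulAlong_mem R 𝒜 _ j t.1 t.2⟩, Subtype.ext (h2 t.1)⟩

variable {m : ℕ} (e : Fin m ≃ G.edgeSet)

/-- The broken circuit theorem for chromatic homology: toggling the largest active edge does not
change the components, so the chromatic functor inverts the covers of the toggle matching. -/
theorem nonempty_chromaticHomology_iso (i : ℕ) :
    Nonempty (chromaticHomology 𝒜 e i ≅ chromaticHomologyNBC 𝒜 e i) := by
  have h : ∀ j, Nonempty (chromaticHomology 𝒜 e i j ≅ chromaticHomologyNBC 𝒜 e i j) := fun j =>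
    (booleanThin e).nonempty_homology_iso_restrict (chromaticFunctor G 𝒜 ⋙ GradedObject.eval j)
      (toggleMatching e) (NBC e) (isLowerSet_NBC e) (fun _ => activity_eq_zero_iff.symm)
      (fun _ hS h0 => chromaticFunctor_map_bijective 𝒜 (homOfLE hS.le)
        (compMap_toggle_bijective h0 _) j) i
  exact ⟨GradedObject.isoMk _ _ fun j => (h j).some⟩

lemma chromaticHomology_equiv (i : ℕ) (j : ℤ) :
    Nonempty (chromaticHomology 𝒜 e i j ≃ₗ[R] chromaticHomologyNBC 𝒜 e i j) :=
  (nonempty_chromaticHomology_iso 𝒜 e i).map fun φ =>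
    ((GradedObject.eval j).mapIso φ).toLinearEquiv

lemma gradedEulerChar_chromaticHomologyNBC :
    gradedEulerChar (chromaticHomologyNBC 𝒜 e) = gradedEulerChar (chromaticHomology 𝒜 e) := by
  have : ∀ i, gradedRank (chromaticHomologyNBC 𝒜 e i) = gradedRank (chromaticHomology 𝒜 e i) :=
    fun i => gradedRank_congr fun j => (chromaticHomology_equiv 𝒜 e i j).some.finrank_eq.symm
  simp only [gradedEulerChar, this]

lemma isFinitelyGenerated_chromaticHomologyNBC
    (h : IsFinitelyGenerated (chromaticHomology 𝒜 e)) :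
    IsFinitelyGenerated (chromaticHomologyNBC 𝒜 e) := by
  have E := fun i j => (chromaticHomology_equiv 𝒜 e i j).some
  refine ⟨fun i j => ?_, h.2.subset fun ij hij => ?_⟩
  · have := h.1 i j
    exact Module.Finite.equiv (E i j)
  · have : Nontrivial (chromaticHomologyNBC 𝒜 e ij.1 ij.2) := hij
    exact (E ij.1 ij.2).toEquiv.nontrivial

variable [IsDomain R] [∀ j, Module.Free R (𝒜 j)] [Module.Finite R A]

variable (G) in
lemma exists_subsingleton_chromaticFunctor :
    ∃ J : Finset ℤ, ∀ S : Finset G.edgeSet, ∀ j ∉ J,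
      Subsingleton ((chromaticFunctor G 𝒜).obj S j) := by
  classical
  have : Finite G.edgeSet := Subtype.finite
  have := Fintype.ofFinite G.edgeSet
  choose J hJ using fun S : Finset G.edgeSet => exists_subsingleton_tensorDegree 𝒜 (Comp S)
  exact ⟨Finset.univ.biUnion J, fun S j hj =>
    hJ S j fun h => hj (Finset.mem_biUnion.2 ⟨S, Finset.mem_univ _, h⟩)⟩

variable [IsNoetherianRing R]

lemma isFinitelyGenerated_chromaticHomology :
    IsFinitelyGenerated (chromaticHomology 𝒜 e) := by
  have : Finite G.edgeSet := Subtype.finite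
  obtain ⟨J, hJ⟩ := exists_subsingleton_chromaticFunctor G 𝒜
  exact (booleanThin e).isFinitelyGenerated_cohomology _
    (fun S j => finite_tensorDegree 𝒜 (Comp S) j) hJ

/-- The graded Euler characteristic of chromatic homology is the chromatic polynomial of `G`,
evaluated at the graded rank of `A`. -/
theorem gradedEulerChar_chromaticHomology :
    gradedEulerChar (chromaticHomology 𝒜 e) =
      Polynomial.aeval (gradedRank fun j => ModuleCat.of R (𝒜 j)) (chromaticPolynomial G) := by
  have : Finite G.edgeSet := Subtype.finite
  have := Fintype.ofFinite (Finset G.edgeSet)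
  obtain ⟨J, hJ⟩ := exists_subsingleton_chromaticFunctor G 𝒜
  have h1 := (booleanThin e).gradedEulerChar_cohomology (chromaticFunctor G 𝒜)
    (fun S j => inferInstanceAs (Module.Free R (tensorDegree R 𝒜 (Comp S) j)))
    (fun S j => finite_tensorDegree 𝒜 (Comp S) j) hJ
  rw [chromaticPolynomial, finsum_eq_sum_of_fintype, map_sum]
  refine h1.trans (Finset.sum_congr rfl fun S _ => ?_)
  rw [gradedRank_tensorDegree 𝒜 (I := Comp S) (M := (chromaticFunctor G 𝒜).obj S) fun j => rfl]
  simp only [map_mul, map_pow, map_neg, map_one, Polynomial.aeval_X]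
  rfl

end Chromatic

end

theorem mainTheorem1 {V : Type*} [Finite V] (G : SimpleGraph V) {m : ℕ} (e : Fin m ≃ G.edgeSet)
    {R : Type*} [CommRing R] {A : Type*} [CommRing A] [Algebra R A]
    (𝒜 : ℤ → Submodule R A) [GradedAlgebra 𝒜]
    (hfree : ∀ j, Module.Free R (𝒜 j)) (hfin : ∀ j, Module.Finite R (𝒜 j)) :
    (∀ i : ℕ, Nonempty (chromaticHomology 𝒜 e i ≅ chromaticHomologyNBC 𝒜 e i)) ∧
    ∃ χ : Polynomial ℤ,
      (∀ n : ℕ, χ.eval (n : ℤ) = Nat.card (G.Coloring (Fin n))) ∧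
      (IsDomain R → IsPrincipalIdealRing R → Module.Finite R A →
        IsFinitelyGenerated (chromaticHomology 𝒜 e) ∧
        IsFinitelyGenerated (chromaticHomologyNBC 𝒜 e) ∧
        gradedEulerChar (chromaticHomology 𝒜 e) =
          Polynomial.aeval (gradedRank fun j => ModuleCat.of R (𝒜 j)) χ ∧
        gradedEulerChar (chromaticHomologyNBC 𝒜 e) =
          ∑ᶠ S ∈ NBC e, (-1) ^ S.card *
            (gradedRank fun j => ModuleCat.of R (𝒜 j)) ^ numComp S) ∧
      (∑ᶠ S ∈ (NBC e)ᶜ, (-1) ^ S.card * (Polynomial.X : Polynomial ℤ) ^ numComp S = 0) ∧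
      χ = ∑ᶠ S ∈ NBC e, (-1) ^ S.card * (Polynomial.X : Polynomial ℤ) ^ numComp S := by
  refine ⟨nonempty_chromaticHomology_iso 𝒜 e, chromaticPolynomial G, eval_chromaticPolynomial,
    fun _ _ _ => ⟨isFinitelyGenerated_chromaticHomology 𝒜 e,
      isFinitelyGenerated_chromaticHomologyNBC 𝒜 e (isFinitelyGenerated_chromaticHomology 𝒜 e),
      gradedEulerChar_chromaticHomology 𝒜 e, ?_⟩,
    finsum_compl_NBC_eq_zero e, chromaticPolynomial_eq_finsum_NBC e⟩
  have : Finite G.edgeSet := Subtype.finite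
  rw [gradedEulerChar_chromaticHomologyNBC, gradedEulerChar_chromaticHomology,
    chromaticPolynomial_eq_finsum_NBC e, finsum_mem_eq_finite_toFinset_sum _ (Set.toFinite _),
    finsum_mem_eq_finite_toFinset_sum _ (Set.toFinite _), map_sum]
  simp only [map_mul, map_pow, map_neg, map_one, Polynomial.aeval_X]
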